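/- Let $\mathbb S=\{y_0<y_1<\dots<y_N\}\subset\mathbb R$ be finite, let $G=(G(x,z))_{x,z\in\mathbb S}$ be a transition rate matrix ($G(x,z)\ge 0$ for $z\ne x$ and $G(x,x)=-\sum_{z\neq x}G(x,z)$), and let $Y$ be a continuous-time Markov chain on $\mathbb S$ with right-continuous paths and transition rate matrix $G$, with law $\mathbb P_x$ when started from $Y_0=x$. Fix $a>0$, $q\in\mathbb C$ with $\Re q>0$, and $f:\mathbb S\times\mathbb S\to\mathbb C$. For $S\subseteq\mathbb R$ let $T_S=\inf\{t>0: Y_t\notin S\}$ and, for $k,g:\mathbb S\to\mathbb C$, $$P_S(k,x;g)=\mathbb E_x\Big[e^{-\int_0^{T_S}k(Y_s)\,ds}\,\mathbf 1_{\{T_S<\infty\}}\,g(Y_{T_S})\Big];$$ $P_S(q,x;g)$ denotes the case of the constant function $k\equiv q$. For $x\le y$ in $\mathbb S$, conditioning on $Y_0=x$, $\overline Y_0=y$ means that $Y$ starts from $x$ and that $\overline Y_t=\max\{y,\sup_{0\le u\le t}Y_u\}$. Put $\overline Y_{s,t}=\sup_{s\le u\le t}Y_u$. The drawdown times with recovery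 are $\tau_{a,0}=0$ and $$\tau_{a,n}=\inf\{t>\tau_{a,n-1}:\ \overline Y_t-Y_t\ge a,\ \overline Y_{\tau_{a,n-1},t}\ge\overline Y_{\tau_{a,n-1}}\},\qquad n\ge1,$$ that is, after $\tau_{a,n-1}$ the chain must first get back to the running maximum it had at time $\tau_{a,n-1}$; here $\inf\emptyset=\infty$, and $\tau_{a,n}=\infty$ if $\tau_{a,n-1}=\infty$. For $n\ge0$ let $$J_n(q,x,y)=\mathbb E\big[e^{-q\tau_{a,n}}f(Y_{\tau_{a,n}},\overline Y_{\tau_{a,n}})\,\big|\,Y_0=x,\ \overline Y_0=y\big],$$ where the integrand is $0$ on $\{\tau_{a,n}=\infty\}$. Then the integrands of $P_S(q,x;g)$ (for all $S$, $g$, $x$) and of $J_n(q,x,y)$ (for all $n\ge 0$, $x\le y$) are integrable, and for all $n\ge1$ and all $x,y\in\mathbb S$ with $x\le y$, $$J_n(q,x,y)=\sum_{z\in\mathbb S,\,z\ge y}P_{(-\infty,y)}\big(q,x;\mathbf 1_{\{\cdot=z\}}\big)\,J_n(q,z,z),$$ $$J_n(q,y,y)=P_{(y-a,y]}\big(q,y;J_{n-1}(q,\cdot,y)\mathbf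 1_{\{\cdot\le y-a\}}\big)+\sum_{z\in\mathbb S,\,z>y}P_{(y-a,y]}\big(q,y;\mathbf 1_{\{\cdot=z\}}\big)\,J_n(q,z,z),$$ with the initial condition $J_0(q,x,y)=f(x,y)$ for $x\le y$. -/

import Mathlib

open MeasureTheory
open scoped NNReal ENNReal

namespace CTMCDrawdown

noncomputable section

/-- `G` is a transition rate matrix: the off-diagonal entries are nonnegative and
`G x x = - ∑_{z ≠ x} G x z`. -/
structure IsRateMatrix {N : ℕ} (G : Matrix (Fin (N + 1)) (Fin (N + 1)) ℝ) : Prop where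
  nonneg : ∀ x z, z ≠ x → 0 ≤ G x z
  diag : ∀ x, G x x = -∑ z ∈ Finset.univ.filter (fun z => z ≠ x), G x z

/-- `(Y_t)_{t ≥ 0}` under the family `(P x)_x` of probability measures is a continuous-time Markov
chain with transition rate matrix `G`: its paths are right-continuous (the finite state set carries
the discrete topology), and under `P x` it starts in `x` and has the finite-dimensional
distributions `P x (Y_{t_0} = z_0, …, Y_{t_n} = z_n) = 1_{z_0 = x} ∏_i e^{(t_{i+1} - t_i) G}(z_i, z_{i+1})`
for `0 = t_0 ≤ t_1 ≤ … ≤ t_n`. A state is named by its index. -/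
structure IsCTMC {N : ℕ} (G : Matrix (Fin (N + 1)) (Fin (N + 1)) ℝ)
    {Ω : Type*} [MeasurableSpace Ω] (P : Fin (N + 1) → Measure Ω)
    (Y : ℝ≥0 → Ω → Fin (N + 1)) : Prop where
  prob : ∀ x, IsProbabilityMeasure (P x)
  meas : ∀ t, Measurable (Y t)
  right_cont : ∀ (ω : Ω) (t : ℝ≥0), ContinuousWithinAt (fun s => Y s ω) (Set.Ici t) t
  fdd : ∀ (x : Fin (N + 1)) (n : ℕ) (t : ℕ → ℝ≥0) (z : ℕ → Fin (N + 1)),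
    t 0 = 0 → Monotone t →
    (P x).real {ω | ∀ i ≤ n, Y (t i) ω = z i} =
      (if z 0 = x then 1 else 0) *
        ∏ i ∈ Finset.range n,
          NormedSpace.exp (((t (i + 1) : ℝ) - (t i : ℝ)) • G) (z i) (z (i + 1))

/-- The first passage time `T_S = inf {t > 0 : w_t ∉ S}` of a path `w`, with `inf ∅ = ∞`;
`grid i` is the real number that the state with index `i` stands for. -/
def firstPassage {N : ℕ} (grid : Fin (N + 1) → ℝ) (S : Set ℝ) (w : ℝ≥0 → Fin (N + 1)) : ℝ≥0∞ :=
  ⨅ (t : ℝ≥0) (_ : 0 < t ∧ grid (w t) ∉ S), (t : ℝ≥0∞)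

/-- `e^{-∫_0^{T_S} k(w_s) ds} 1_{T_S < ∞} g(w_{T_S})` for a path `w`. -/
def passagePayoff {N : ℕ} (grid : Fin (N + 1) → ℝ) (S : Set ℝ) (k g : Fin (N + 1) → ℂ)
    (w : ℝ≥0 → Fin (N + 1)) : ℂ :=
  if firstPassage grid S w < ⊤ then
    Complex.exp (-∫ s in (0 : ℝ)..(firstPassage grid S w).toReal, k (w s.toNNReal)) *
      g (w (firstPassage grid S w).toNNReal)
  else 0

/-- `P_S(k, x; g) = E[e^{-∫_0^{T_S} k(Y_s) ds} 1_{T_S < ∞} g(Y_{T_S}) | Y_0 = x]`. -/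
def passage {N : ℕ} (grid : Fin (N + 1) → ℝ) {Ω : Type*} [MeasurableSpace Ω]
    (P : Fin (N + 1) → Measure Ω) (Y : ℝ≥0 → Ω → Fin (N + 1))
    (S : Set ℝ) (k : Fin (N + 1) → ℂ) (x : Fin (N + 1)) (g : Fin (N + 1) → ℂ) : ℂ :=
  ∫ ω, passagePayoff grid S k g (fun t => Y t ω) ∂(P x)

/-- The maximum `sup_{s ≤ u ≤ t} w_u` over a time window (as a state; the set of indices is a
finite linear order, hence complete). -/
def windowMax {N : ℕ} (w : ℝ≥0 → Fin (N + 1)) (s t : ℝ≥0) : Fin (N + 1) :=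
  ⨆ u ∈ Set.Icc s t, w u

/-- The running maximum at time `t`, started at time `0` from the historical maximum `y`. -/
def runMax {N : ℕ} (y : Fin (N + 1)) (w : ℝ≥0 → Fin (N + 1)) (t : ℝ≥0) : Fin (N + 1) :=
  max y (windowMax w 0 t)

/-- The `n`-th drawdown time with recovery `τ_{a,n}` of a path `w` with historical maximum `y`:
`τ_{a,0} = 0`, and `τ_{a,n+1}` is the infimum of the times `t > τ_{a,n}` at which the drawdown from
the running maximum is at least `a` and by which the path has, since `τ_{a,n}`, got back to the
running maximum of time `τ_{a,n}`. Here `inf ∅ = ∞`, and `τ_{a,n+1} = ∞` if `τ_{a,n} = ∞`. -/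
def drawdownTime {N : ℕ} (grid : Fin (N + 1) → ℝ) (a : ℝ) (y : Fin (N + 1))
    (w : ℝ≥0 → Fin (N + 1)) : ℕ → ℝ≥0∞
  | 0 => 0
  | n + 1 =>
    ⨅ (t : ℝ≥0) (_ : drawdownTime grid a y w n < (t : ℝ≥0∞) ∧
        a ≤ grid (runMax y w t) - grid (w t) ∧
        runMax y w (drawdownTime grid a y w n).toNNReal ≤
          windowMax w (drawdownTime grid a y w n).toNNReal t), (t : ℝ≥0∞)

/-- `e^{-q τ_{a,n}} f(w_{τ_{a,n}}, w̄_{τ_{a,n}})` for a path `w` with historical maximum `y`,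
read as `0` if `τ_{a,n} = ∞`. -/
def drawdownPayoff {N : ℕ} (grid : Fin (N + 1) → ℝ) (a : ℝ)
    (f : Fin (N + 1) → Fin (N + 1) → ℂ) (n : ℕ) (q : ℂ) (y : Fin (N + 1))
    (w : ℝ≥0 → Fin (N + 1)) : ℂ :=
  if drawdownTime grid a y w n < ⊤ then
    Complex.exp (-(q * ((drawdownTime grid a y w n).toReal : ℂ))) *
      f (w (drawdownTime grid a y w n).toNNReal)
        (runMax y w (drawdownTime grid a y w n).toNNReal)
  else 0

/-- `J_n(q, x, y) = E[e^{-q τ_{a,n}} f(Y_{τ_{a,n}}, Ȳ_{τ_{a,n}}) | Y_0 = x, Ȳ_0 = y]`. -/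
def J {N : ℕ} (grid : Fin (N + 1) → ℝ) {Ω : Type*} [MeasurableSpace Ω]
    (P : Fin (N + 1) → Measure Ω) (Y : ℝ≥0 → Ω → Fin (N + 1)) (a : ℝ)
    (f : Fin (N + 1) → Fin (N + 1) → ℂ) (n : ℕ) (q : ℂ) (x y : Fin (N + 1)) : ℂ :=
  ∫ ω, drawdownPayoff grid a f n q y (fun t => Y t ω) ∂(P x)

end

end CTMCDrawdown

/-!
Let `T` be the first exit time from `(-∞, y)` when `Y` starts from `x ≤ y`, or from `(y - a, y]`
when it starts from `y`. No drawdown time with recovery occurs before `T`, and at `T` the recursion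
for the drawdown times starts afresh: if the path has reached a new maximum `Y_T ≥ y`, then `τ_n` is
`T` plus the `n`-th such time for the path after `T` with historical maximum `Y_T`; if the path
has dropped to `Y_T ≤ y - a`, then `τ_1 = T`, and `τ_n` is `T` plus the `(n - 1)`-th such time for
the path after `T` with historical maximum `y`. The linear system follows by conditioning on `Y_T`.

The strong Markov property needed for this is derived from the finite-dimensional distributions: it
holds for random times with countably many values, and an optional time `T` is approximated from
above by such times, along which the state and finitely many later coordinates are eventually
constant by right-continuity.
-/

namespace CTMCDrawdown

open Filter Topology Set

/-! ### Step paths -/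

/-- A function of time that is locally constant to the right of every time: right-continuity for
the discrete topology on the state space, phrased without a topology. -/
def IsRightStep {β : Type*} (w : ℝ≥0 → β) : Prop := ∀ t, ∀ᶠ s in 𝓝[≥] t, w s = w t

section RightStep

variable {β : Type*} {w : ℝ≥0 → β}

theorem IsRightStep.exists_Ico (hw : IsRightStep w) {t c : ℝ≥0} (htc : t < c) :
    ∃ u, t < u ∧ u ≤ c ∧ ∀ s, t ≤ s → s < u → w s = w t := by
  obtain ⟨u, hu, h⟩ := (mem_nhdsGE_iff_exists_mem_Ioc_Ico_subset htc).1 (hw t)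
  exact ⟨u, hu.1, hu.2, fun s hts hsu => h ⟨hts, hsu⟩⟩

theorem isRightStep_of_exists (h : ∀ t, ∃ u, t < u ∧ ∀ s, t ≤ s → s < u → w s = w t) :
    IsRightStep w := by
  intro t
  obtain ⟨u, hu, h⟩ := h t
  filter_upwards [Ico_mem_nhdsGE hu] with s hs using h s hs.1 hs.2

theorem isRightStep_of_continuousWithinAt [TopologicalSpace β] [DiscreteTopology β]
    (h : ∀ t, ContinuousWithinAt w (Ici t) t) : IsRightStep w := by
  intro t
  have ht := h t
  rwa [ContinuousWithinAt, nhds_discrete, tendsto_pure] at ht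

/-- The least point of the grid `(m + 1)⁻¹ ℕ` strictly after `T`; it approximates `T` from above
by times with countably many values. -/
noncomputable def gridCeil (m : ℕ) (T : ℝ≥0) : ℝ≥0 := (⌊((m : ℝ≥0) + 1) * T⌋₊ + 1) / (m + 1)

theorem lt_gridCeil (m : ℕ) (T : ℝ≥0) : T < gridCeil m T := by
  rw [gridCeil, lt_div_iff₀ (by positivity), mul_comm]
  exact Nat.lt_floor_add_one _

theorem gridCeil_le (m : ℕ) (T : ℝ≥0) : gridCeil m T ≤ T + 1 / (m + 1) := by
  rw [gridCeil, add_div]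
  gcongr
  rw [div_le_iff₀ (by positivity), mul_comm]
  exact Nat.floor_le zero_le

theorem tendsto_gridCeil (T : ℝ≥0) : Tendsto (fun m => gridCeil m T) atTop (𝓝[≥] T) := by
  refine tendsto_nhdsWithin_iff.2 ⟨?_, Eventually.of_forall fun m => (lt_gridCeil m T).le⟩
  have hlim : Tendsto (fun m : ℕ => T + 1 / ((m : ℝ≥0) + 1)) atTop (𝓝 T) := by
    simpa using tendsto_const_nhds.add (tendsto_one_div_add_atTop_nhds_zero_nat (𝕜 := ℝ≥0))
  exact tendsto_of_tendsto_of_tendsto_of_le_of_le tendsto_const_nhds hlim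
    (fun m => (lt_gridCeil m T).le) (fun m => gridCeil_le m T)

theorem IsRightStep.eventually_gridCeil_add (hw : IsRightStep w) (T s : ℝ≥0) :
    ∀ᶠ m in atTop, w (gridCeil m T + s) = w (T + s) := by
  have hlim : Tendsto (fun m => gridCeil m T + s) atTop (𝓝[≥] (T + s)) :=
    tendsto_nhdsWithin_iff.2
      ⟨((tendsto_nhdsWithin_iff.1 (tendsto_gridCeil T)).1).add_const s,
        Eventually.of_forall fun m => add_le_add_left (lt_gridCeil m T).le s⟩
  exact hlim.eventually (hw (T + s))

theorem measurable_comp_countable {α ι : Type*} [MeasurableSpace α] [MeasurableSpace β]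
    [MeasurableSpace ι] [Countable ι] [MeasurableSingletonClass ι] {X : ι → α → β}
    (hX : ∀ i, Measurable (X i)) {κ : α → ι} (hκ : Measurable κ) :
    Measurable fun ω => X (κ ω) ω :=
  (measurable_from_prod_countable_right (f := fun p : ι × α => X p.1 p.2) hX).comp
    (hκ.prodMk measurable_id)

theorem IsRightStep.measurable_eval {α : Type*} [MeasurableSpace α] [MeasurableSpace β]
    [Countable β] [MeasurableSingletonClass β] {X : ℝ≥0 → α → β} (hX : ∀ t, Measurable (X t))
    (hr : ∀ ω, IsRightStep fun t => X t ω) {τ : α → ℝ≥0} (hτ : Measurable τ) :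
    Measurable fun ω => X (τ ω) ω := by
  let _ : TopologicalSpace β := ⊥
  have : DiscreteTopology β := ⟨rfl⟩
  have hgrid (m : ℕ) : Measurable fun ω => X (gridCeil m (τ ω)) ω :=
    measurable_comp_countable (X := fun k : ℕ => X ((k + 1) / (m + 1))) (fun _ => hX _)
      (Nat.measurable_floor.comp (hτ.const_mul ((m : ℝ≥0) + 1)))
  refine measurable_of_tendsto_metrizable hgrid (tendsto_pi_nhds.2 fun ω => ?_)
  rw [nhds_discrete, tendsto_pure]
  exact (tendsto_gridCeil (τ ω)).eventually (hr ω (τ ω))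

end RightStep

/-- The space of right-continuous step paths, with the σ-algebra generated by the coordinates. -/
abbrev StepPath (E : Type*) : Type _ := {w : ℝ≥0 → E // IsRightStep w}

namespace StepPath

variable {E : Type*}

/-- The path after time `T`, with the clock restarted. -/
def shift (T : ℝ≥0) (w : StepPath E) : StepPath E :=
  ⟨fun s => w.1 (T + s), isRightStep_of_exists fun t => by
    obtain ⟨u, htu, -, hu⟩ := w.2.exists_Ico (lt_add_one (T + t))
    refine ⟨u - T, lt_tsub_iff_left.2 htu, fun s hts hsu => hu _ (by gcongr) ?_⟩
    exact lt_tsub_iff_left.1 hsu⟩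

/-- The path frozen at time `T`: the freezing maps `freeze s`, `s ≤ T`, generate the information
available at time `T`. -/
def freeze (T : ℝ≥0) (w : StepPath E) : StepPath E :=
  ⟨fun s => w.1 (min s T), isRightStep_of_exists fun t => by
    rcases lt_or_ge t T with h | h
    · obtain ⟨u, htu, huT, hu⟩ := w.2.exists_Ico h
      refine ⟨u, htu, fun s hts hsu => ?_⟩
      rw [min_eq_left (hsu.le.trans huT), min_eq_left h.le, hu s hts hsu]
    · refine ⟨t + 1, lt_add_one t, fun s hts _ => ?_⟩
      rw [min_eq_right h, min_eq_right (h.trans hts)]⟩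

@[simp] theorem shift_apply (T : ℝ≥0) (w : StepPath E) (s : ℝ≥0) :
    (w.shift T).1 s = w.1 (T + s) := rfl

@[simp] theorem freeze_apply (T : ℝ≥0) (w : StepPath E) (s : ℝ≥0) :
    (w.freeze T).1 s = w.1 (min s T) := rfl

theorem freeze_freeze {s t : ℝ≥0} (hst : s ≤ t) (w : StepPath E) :
    (w.freeze t).freeze s = w.freeze s := by
  ext r
  simp [min_assoc, min_eq_left hst]

/-- The paths with prescribed values at finitely many times. -/
def pathCylinder (I : Finset ℝ≥0) (ζ : ℝ≥0 → E) : Set (StepPath E) := {w | ∀ s ∈ I, w.1 s = ζ s}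

theorem mem_pathCylinder {I : Finset ℝ≥0} {ζ : ℝ≥0 → E} {w : StepPath E} :
    w ∈ pathCylinder I ζ ↔ ∀ s ∈ I, w.1 s = ζ s := Iff.rfl

theorem pathCylinder_eq_of_mem {I : Finset ℝ≥0} {ζ : ℝ≥0 → E} {w₀ : StepPath E}
    (hw₀ : w₀ ∈ pathCylinder I ζ) : pathCylinder I ζ = pathCylinder I w₀.1 := by
  ext w
  exact forall₂_congr fun s hs => by rw [hw₀ s hs]

theorem pathCylinder_inter_pathCylinder [DecidableEq ℝ≥0] (I J : Finset ℝ≥0) (ζ : ℝ≥0 → E) :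
    pathCylinder I ζ ∩ pathCylinder J ζ = pathCylinder (I ∪ J) ζ := by
  ext w
  simp only [mem_inter_iff, mem_pathCylinder, Finset.forall_mem_union]

theorem isPiSystem_pathCylinder :
    IsPiSystem {C : Set (StepPath E) | ∃ I ζ, C = pathCylinder I ζ} := by
  classical
  rintro _ ⟨I, ζ, rfl⟩ _ ⟨J, ξ, rfl⟩ ⟨w₀, hI, hJ⟩
  exact ⟨I ∪ J, w₀.1, by
    rw [pathCylinder_eq_of_mem hI, pathCylinder_eq_of_mem hJ, pathCylinder_inter_pathCylinder]⟩

variable [MeasurableSpace E]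

theorem measurable_coord (t : ℝ≥0) : Measurable fun w : StepPath E => w.1 t :=
  (measurable_pi_apply t).comp measurable_subtype_coe

theorem measurable_of_coord {α : Type*} [MeasurableSpace α] {F : α → StepPath E}
    (h : ∀ t, Measurable fun a => (F a).1 t) : Measurable F :=
  Measurable.subtype_mk (f := fun a => (F a).1) (measurable_pi_iff.2 h)

theorem measurable_shift (T : ℝ≥0) : Measurable (shift (E := E) T) :=
  measurable_of_coord fun s => measurable_coord (T + s)

theorem measurable_freeze (T : ℝ≥0) : Measurable (freeze (E := E) T) :=
  measurable_of_coord fun s => measurable_coord (min s T)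

section Singleton

variable [MeasurableSingletonClass E]

theorem measurableSet_pathCylinder (I : Finset ℝ≥0) (ζ : ℝ≥0 → E) :
    MeasurableSet (pathCylinder I ζ) := by
  have hI : pathCylinder I ζ = ⋂ s ∈ I, (fun w : StepPath E => w.1 s) ⁻¹' {ζ s} := by
    ext w; simp [mem_pathCylinder]
  rw [hI]
  exact Finset.measurableSet_biInter I fun s _ => measurable_coord s (measurableSet_singleton _)

variable [Countable E]

theorem measurable_eval {τ : StepPath E → ℝ≥0} (hτ : Measurable τ) :
    Measurable fun w : StepPath E => w.1 (τ w) :=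
  IsRightStep.measurable_eval (X := fun t (w : StepPath E) => w.1 t)
    measurable_coord (fun w => w.2) hτ

theorem measurable_shift_of_measurable {τ : StepPath E → ℝ≥0} (hτ : Measurable τ) :
    Measurable fun w : StepPath E => w.shift (τ w) :=
  measurable_of_coord fun s => measurable_eval (hτ.add_const s)

theorem generateFrom_pathCylinder :
    (inferInstance : MeasurableSpace (StepPath E)) =
      MeasurableSpace.generateFrom {C | ∃ I ζ, C = pathCylinder I ζ} := by
  apply le_antisymm
  · refine Measurable.comap_le (@measurable_pi_lambda _ _ _ (.generateFrom _) _ _ fun t => ?_)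
    refine @measurable_to_countable' _ _ _ _ (.generateFrom _) _ fun z => ?_
    exact .basic _ ⟨{t}, fun _ => z, by ext w; simp [mem_pathCylinder]⟩
  · refine MeasurableSpace.generateFrom_le ?_
    rintro _ ⟨I, ζ, rfl⟩
    exact measurableSet_pathCylinder I ζ

theorem ext_of_pathCylinder {μ ν : Measure (StepPath E)} [IsFiniteMeasure μ]
    (h : ∀ I ζ, μ (pathCylinder I ζ) = ν (pathCylinder I ζ)) : μ = ν := by
  refine ext_of_generate_finite _ generateFrom_pathCylinder isPiSystem_pathCylinder ?_ ?_
  · rintro _ ⟨I, ζ, rfl⟩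
    exact h I ζ
  · rcases isEmpty_or_nonempty (StepPath E) with _ | ⟨⟨w⟩⟩
    · simp only [univ_eq_empty_iff.2 ‹_›, measure_empty]
    · simpa [pathCylinder] using h ∅ w.1

theorem measure_inter_preimage_eq_mul {Ω : Type*} [MeasurableSpace Ω] {μ : Measure Ω}
    [IsFiniteMeasure μ] {ν : Measure (StepPath E)} {S : Set Ω} {F : Ω → StepPath E}
    (hF : Measurable F) {c : ℝ≥0∞}
    (h : ∀ I ζ, μ (S ∩ F ⁻¹' pathCylinder I ζ) = c * ν (pathCylinder I ζ))
    {A : Set (StepPath E)} (hA : MeasurableSet A) : μ (S ∩ F ⁻¹' A) = c * ν A := by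
  have hmap {B : Set (StepPath E)} (hB : MeasurableSet B) :
      (μ.restrict S).map F B = μ (S ∩ F ⁻¹' B) := by
    rw [Measure.map_apply hF hB, Measure.restrict_apply (hF hB), inter_comm]
  have heq : (μ.restrict S).map F = c • ν := ext_of_pathCylinder fun I ζ => by
    rw [hmap (measurableSet_pathCylinder I ζ), h, Measure.smul_apply, smul_eq_mul]
  rw [← hmap hA, heq, Measure.smul_apply, smul_eq_mul]

end Singleton

end StepPath

/-! ### Markov laws on path space -/

theorem exists_monotone_forall_mem_iff {α : Type*} [LinearOrder α] {I : Finset α} {T : α}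
    (hT : IsGreatest (I : Set α) T) :
    ∃ (n : ℕ) (t : ℕ → α), Monotone t ∧ t n = T ∧
      ∀ p : α → Prop, (∀ s ∈ I, p s) ↔ ∀ i ≤ n, p (t i) := by
  obtain ⟨n, hn⟩ : ∃ n, I.card = n + 1 :=
    Nat.exists_eq_succ_of_ne_zero (Finset.card_ne_zero_of_mem hT.1)
  let t : ℕ → α := fun i => I.orderEmbOfFin hn ⟨min i n, by omega⟩
  have mem_iff (s : α) : s ∈ I ↔ ∃ i ≤ n, t i = s := by
    rw [← Finset.mem_coe, ← Finset.range_orderEmbOfFin I hn]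
    constructor
    · rintro ⟨i, rfl⟩
      exact ⟨i, by omega, by simp only [t, min_eq_left (show (i : ℕ) ≤ n by omega)]⟩
    · rintro ⟨i, -, rfl⟩
      exact mem_range_self _
  have t_mono : Monotone t := fun i j hij => (I.orderEmbOfFin hn).monotone
    (Fin.mk_le_mk.2 (min_le_min_right n hij))
  refine ⟨n, t, t_mono, le_antisymm (hT.2 ((mem_iff _).2 ⟨n, le_rfl, rfl⟩)) ?_, fun p => ?_⟩
  · obtain ⟨i, hi, hiT⟩ := (mem_iff T).1 hT.1
    exact hiT ▸ t_mono hi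
  · simp only [mem_iff, forall_exists_index, and_imp, forall_apply_eq_imp_iff₂]

/-- The sequence `u 0, …, u n, v 0, v 1, …`. -/
def concat {α : Type*} (n : ℕ) (u v : ℕ → α) (i : ℕ) : α := if i ≤ n then u i else v (i - (n + 1))

section Concat

variable {α : Type*} {n : ℕ} {u v : ℕ → α}

theorem concat_of_le {i : ℕ} (hi : i ≤ n) : concat n u v i = u i := if_pos hi

theorem concat_add (j : ℕ) : concat n u v (n + 1 + j) = v j := by
  rw [concat, if_neg (by omega), Nat.add_sub_cancel_left]

theorem monotone_concat [Preorder α] (hu : Monotone u) (hv : Monotone v) (huv : u n ≤ v 0) :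
    Monotone (concat n u v) := by
  refine monotone_nat_of_le_succ fun i => ?_
  rcases lt_trichotomy i n with hi | rfl | hi
  · rw [concat_of_le hi.le, concat_of_le hi]
    exact hu i.le_succ
  · rw [concat_of_le le_rfl]
    exact huv.trans_eq (concat_add 0).symm
  · obtain ⟨j, rfl⟩ := Nat.exists_eq_add_of_lt hi
    rw [show n + j + 1 = n + 1 + j by ring, concat_add, add_assoc, concat_add]
    exact hv j.le_succ

theorem forall_concat_iff {β : Type*} {z z' : ℕ → β} (m : ℕ) (R : α → β → Prop) :
    (∀ i ≤ n + 1 + m, R (concat n u v i) (concat n z z' i)) ↔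
      (∀ i ≤ n, R (u i) (z i)) ∧ ∀ j ≤ m, R (v j) (z' j) := by
  refine ⟨fun h => ⟨fun i hi => ?_, fun j hj => ?_⟩, fun ⟨hl, hr⟩ i hi => ?_⟩
  · simpa only [concat_of_le hi] using h i (by omega)
  · simpa only [concat_add] using h (n + 1 + j) (by omega)
  · rcases le_or_gt i n with hin | hin
    · simpa only [concat_of_le hin] using hl i hin
    · obtain ⟨j, rfl⟩ := Nat.exists_eq_add_of_le (Nat.succ_le_of_lt hin)
      simpa only [concat_add] using hr j (by omega)

end Concat

open StepPath

/-- The coordinate process on path space under `(μ x)_x` has the finite-dimensional distributions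
of a time-homogeneous Markov chain with transition function `p`, started from `x` under `μ x`. -/
structure IsMarkovLaw {E : Type*} [MeasurableSpace E] (p : ℝ≥0 → E → E → ℝ)
    (μ : E → Measure (StepPath E)) : Prop where
  prob : ∀ x, IsProbabilityMeasure (μ x)
  fdd : ∀ (x : E) (n : ℕ) (t : ℕ → ℝ≥0) (z : ℕ → E), Monotone t →
    (μ x).real {w | ∀ i ≤ n, w.1 (t i) = z i} =
      p (t 0) x (z 0) * ∏ i ∈ Finset.range n, p (t (i + 1) - t i) (z i) (z (i + 1))

namespace IsMarkovLaw

variable {E : Type*} [MeasurableSpace E] {p : ℝ≥0 → E → E → ℝ} {μ : E → Measure (StepPath E)}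

theorem measureReal_inter_shift (hμ : IsMarkovLaw p μ) (x : E) (n m : ℕ) {t s : ℕ → ℝ≥0}
    (z z' : ℕ → E) (ht : Monotone t) (hs : Monotone s) :
    (μ x).real ({w | ∀ i ≤ n, w.1 (t i) = z i} ∩
        shift (t n) ⁻¹' {w | ∀ j ≤ m, w.1 (s j) = z' j}) =
      (μ x).real {w | ∀ i ≤ n, w.1 (t i) = z i} *
        (μ (z n)).real {w | ∀ j ≤ m, w.1 (s j) = z' j} := by
  have hset : {w : StepPath E | ∀ i ≤ n, w.1 (t i) = z i} ∩
        shift (t n) ⁻¹' {w | ∀ j ≤ m, w.1 (s j) = z' j} =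
      {w | ∀ i ≤ n + 1 + m, w.1 (concat n t (fun j => t n + s j) i) = concat n z z' i} := by
    ext w
    exact (forall_concat_iff m fun r y => w.1 r = y).symm
  have hmono : Monotone (concat n t fun j => t n + s j) :=
    monotone_concat ht (hs.const_add _) le_self_add
  rw [hset, hμ.fdd x _ _ _ hmono, hμ.fdd x n t z ht, hμ.fdd (z n) m s z' hs,
    Finset.prod_range_add, Finset.prod_range_succ, concat_of_le n.zero_le, concat_of_le n.zero_le,
    concat_of_le le_rfl, concat_of_le le_rfl, ← add_zero (n + 1), concat_add, concat_add,
    add_tsub_cancel_left]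
  have hhead (i) (hi : i ∈ Finset.range n) :
      p (concat n t (fun j => t n + s j) (i + 1) - concat n t (fun j => t n + s j) i)
        (concat n z z' i) (concat n z z' (i + 1)) = p (t (i + 1) - t i) (z i) (z (i + 1)) := by
    rw [Finset.mem_range] at hi
    simp only [concat_of_le hi.le, concat_of_le (Nat.succ_le_of_lt hi)]
  rw [Finset.prod_congr rfl hhead]
  simp only [add_zero, add_assoc (n + 1), concat_add, add_tsub_add_eq_tsub_left]
  ring

theorem measure_pathCylinder_inter_shift (hμ : IsMarkovLaw p μ) (x : E) {I : Finset ℝ≥0} {T : ℝ≥0}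
    (hT : IsGreatest (I : Set ℝ≥0) T) (J : Finset ℝ≥0) (ζ ξ : ℝ≥0 → E) :
    μ x (pathCylinder I ζ ∩ shift T ⁻¹' pathCylinder J ξ) =
      μ x (pathCylinder I ζ) * μ (ζ T) (pathCylinder J ξ) := by
  have := hμ.prob
  rcases J.eq_empty_or_nonempty with rfl | hJ
  · simp [pathCylinder]
  obtain ⟨n, t, t_mono, rfl, hI⟩ := exists_monotone_forall_mem_iff hT
  obtain ⟨m, s, s_mono, -, hJ⟩ := exists_monotone_forall_mem_iff (J.isGreatest_max' hJ)
  have hIeq : pathCylinder I ζ = {w | ∀ i ≤ n, w.1 (t i) = ζ (t i)} :=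
    ext fun w => hI fun r => w.1 r = ζ r
  have hJeq : pathCylinder J ξ = {w | ∀ j ≤ m, w.1 (s j) = ξ (s j)} :=
    ext fun w => hJ fun r => w.1 r = ξ r
  have h := hμ.measureReal_inter_shift x n m (fun i => ζ (t i)) (fun j => ξ (s j)) t_mono s_mono
  rw [← hIeq, ← hJeq] at h
  rw [← ofReal_measureReal, h, ENNReal.ofReal_mul measureReal_nonneg, ofReal_measureReal,
    ofReal_measureReal]

theorem measure_pathCylinder_markov (hμ : IsMarkovLaw p μ) (x z : E) (T : ℝ≥0) (I J : Finset ℝ≥0)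
    (ζ ξ : ℝ≥0 → E) :
    μ x ({w | w.1 T = z} ∩ freeze T ⁻¹' pathCylinder I ζ ∩ shift T ⁻¹' pathCylinder J ξ) =
      μ x ({w | w.1 T = z} ∩ freeze T ⁻¹' pathCylinder I ζ) * μ z (pathCylinder J ξ) := by
  classical
  rcases ({w : StepPath E | w.1 T = z} ∩ freeze T ⁻¹' pathCylinder I ζ).eq_empty_or_nonempty
    with h | ⟨w₀, rfl, hw₀⟩
  · simp [h]
  have hpast : {w : StepPath E | w.1 T = w₀.1 T} ∩ freeze T ⁻¹' pathCylinder I ζ =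
      pathCylinder (insert T (I.image (min · T))) w₀.1 := by
    ext w
    rw [pathCylinder_eq_of_mem hw₀]
    simp [mem_pathCylinder]
  have hT : IsGreatest ((insert T (I.image (min · T)) : Finset ℝ≥0) : Set ℝ≥0) T :=
    ⟨by simp, by simp [upperBounds]⟩
  rw [hpast, hμ.measure_pathCylinder_inter_shift x hT]

variable [Countable E] [MeasurableSingletonClass E]

theorem markov (hμ : IsMarkovLaw p μ) (x z : E) (T : ℝ≥0) {B A : Set (StepPath E)}
    (hB : MeasurableSet B) (hA : MeasurableSet A) :
    μ x ({w | w.1 T = z} ∩ freeze T ⁻¹' B ∩ shift T ⁻¹' A) =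
      μ x ({w | w.1 T = z} ∩ freeze T ⁻¹' B) * μ z A := by
  have := hμ.prob
  have hfreeze := measurable_freeze (E := E) T
  let ν := ((μ x).restrict {w | w.1 T = z}).map (freeze T)
  have hν {C : Set (StepPath E)} (hC : MeasurableSet C) :
      ν C = μ x ({w | w.1 T = z} ∩ freeze T ⁻¹' C) := by
    rw [Measure.map_apply hfreeze hC, Measure.restrict_apply (hfreeze hC), inter_comm]
  refine measure_inter_preimage_eq_mul (measurable_shift T) (fun J ξ => ?_) hA
  have hpast := measure_inter_preimage_eq_mul (μ := μ x) (ν := ν)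
    (S := {w | w.1 T = z} ∩ shift T ⁻¹' pathCylinder J ξ) (c := μ z (pathCylinder J ξ)) hfreeze
    (fun I ζ => ?_) hB
  · rw [inter_right_comm, hpast, hν hB, mul_comm]
  · rw [hν (measurableSet_pathCylinder I ζ), inter_right_comm, hμ.measure_pathCylinder_markov,
      mul_comm]

end IsMarkovLaw

/-! ### The strong Markov property -/

/-- `T` is an optional time: whether `T < s` can be read off the path up to time `s`, that is,
`T` is a stopping time of the right-continuous version of the natural filtration. -/
structure IsOptionalTime {E : Type*} [MeasurableSpace E] (T : StepPath E → ℝ≥0∞) : Prop where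
  measurable : Measurable T
  lt_iff : ∀ (w : StepPath E) (s : ℝ≥0), T w < s ↔ T (w.freeze s) < s

/-- The event that `T` is finite and that the path is in `z` at time `T`. -/
def stoppedIn {E : Type*} (T : StepPath E → ℝ≥0∞) (z : E) : Set (StepPath E) :=
  {w | T w < ⊤ ∧ w.1 (T w).toNNReal = z}

namespace IsOptionalTime

variable {E : Type*} [MeasurableSpace E] {T : StepPath E → ℝ≥0∞}

theorem lt_iff_of_le (hT : IsOptionalTime T) (w : StepPath E) {r t : ℝ≥0} (hrt : r ≤ t) :
    T (w.freeze t) < r ↔ T w < r := by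
  rw [hT.lt_iff w r, hT.lt_iff (w.freeze t) r, freeze_freeze hrt]

theorem apply_freeze (hT : IsOptionalTime T) {w : StepPath E} {t : ℝ≥0} (hw : T w < t) :
    T (w.freeze t) = T w := by
  have hw' : T (w.freeze t) < t := (hT.lt_iff w t).1 hw
  refine eq_of_forall_lt_iff fun c => not_iff_not.1 ?_
  simp only [not_lt]
  rcases le_or_gt (t : ℝ≥0∞) c with htc | hct
  · simp only [hw'.le.trans htc, hw.le.trans htc]
  · lift c to ℝ≥0 using hct.ne_top
    refine ⟨fun h => ?_, fun h => ?_⟩ <;> by_contra! hlt <;>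
      obtain ⟨r, hcr, hr⟩ := ENNReal.lt_iff_exists_nnreal_btwn.1 hlt
    · have hrt : r ≤ t := ENNReal.coe_le_coe.1 (hr.trans hw).le
      exact hr.not_gt ((hT.lt_iff_of_le w hrt).1 (h.trans_lt hcr))
    · have hrt : r ≤ t := ENNReal.coe_le_coe.1 (hr.trans hw').le
      exact hr.not_gt ((hT.lt_iff_of_le w hrt).2 (h.trans_lt hcr))

theorem preimage_freeze (hT : IsOptionalTime T) {s : Set ℝ≥0∞} {t : ℝ≥0} (hs : s ⊆ Iio ↑t) :
    freeze t ⁻¹' (T ⁻¹' s) = T ⁻¹' s := by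
  ext w
  refine ⟨fun h => ?_, fun h => ?_⟩
  · rwa [mem_preimage, mem_preimage, hT.apply_freeze ((hT.lt_iff w t).2 (hs h))] at h
  · rwa [mem_preimage, mem_preimage, hT.apply_freeze (hs h)]

theorem measurable_toNNReal (hT : IsOptionalTime T) : Measurable fun w => (T w).toNNReal :=
  hT.measurable.ennreal_toNNReal

variable [Countable E] [MeasurableSingletonClass E]

theorem measurableSet_stoppedIn (hT : IsOptionalTime T) (z : E) :
    MeasurableSet (stoppedIn T z) :=
  (measurableSet_lt hT.measurable measurable_const).inter
    (measurable_eval hT.measurable_toNNReal (measurableSet_singleton z))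

end IsOptionalTime

theorem measure_eq_tsum_inter_preimage_singleton {Ω ι : Type*} [MeasurableSpace Ω]
    [MeasurableSpace ι] [MeasurableSingletonClass ι] [Countable ι] (μ : Measure Ω) {κ : Ω → ι}
    (hκ : Measurable κ) {D : Set Ω} (hD : MeasurableSet D) :
    μ D = ∑' k, μ (D ∩ κ ⁻¹' {k}) := by
  rw [← measure_iUnion (fun i j hij => ?_) fun k => hD.inter (hκ (measurableSet_singleton k)),
    ← inter_iUnion, iUnion_eq_univ_iff.2 fun w => ⟨κ w, rfl⟩, inter_univ]
  exact ((disjoint_singleton.2 hij).preimage κ).mono inter_subset_right inter_subset_right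

namespace IsMarkovLaw

variable {E : Type*} [MeasurableSpace E] [Countable E] [MeasurableSingletonClass E]
  {p : ℝ≥0 → E → E → ℝ} {μ : E → Measure (StepPath E)} {T : StepPath E → ℝ≥0∞}

-- On `{κ = k}` the optional time lies before `t k`, so the event belongs to the past of `t k`.
theorem markov_of_countable (hμ : IsMarkovLaw p μ) (hT : IsOptionalTime T) (x z : E)
    {κ : ℝ≥0∞ → ℕ} (hκ : Measurable κ) (t : ℕ → ℝ≥0) {s : Set ℝ≥0∞} (hs : MeasurableSet s)
    (hst : ∀ τ ∈ s, τ < t (κ τ)) {A : Set (StepPath E)} (hA : MeasurableSet A) :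
    μ x ({w | T w ∈ s ∧ w.1 (t (κ (T w))) = z} ∩ (fun w => w.shift (t (κ (T w)))) ⁻¹' A) =
      μ x {w | T w ∈ s ∧ w.1 (t (κ (T w))) = z} * μ z A := by
  have hκT : Measurable fun w => κ (T w) := hκ.comp hT.measurable
  have htκT : Measurable fun w => t (κ (T w)) := measurable_from_top.comp hκT
  have hevent : MeasurableSet {w | T w ∈ s ∧ w.1 (t (κ (T w))) = z} :=
    (hT.measurable hs).inter (measurable_eval htκT (measurableSet_singleton z))
  have hbefore (k : ℕ) : s ∩ κ ⁻¹' {k} ⊆ Iio ↑(t k) := by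
    rintro τ ⟨hτ, rfl⟩
    exact hst τ hτ
  have hpast (k : ℕ) : {w | T w ∈ s ∧ w.1 (t (κ (T w))) = z} ∩ (fun w => κ (T w)) ⁻¹' {k} =
      {w | w.1 (t k) = z} ∩ freeze (t k) ⁻¹' (T ⁻¹' (s ∩ κ ⁻¹' {k})) := by
    rw [hT.preimage_freeze (hbefore k)]
    ext w
    constructor
    · rintro ⟨⟨hws, hwz⟩, rfl⟩
      exact ⟨hwz, hws, rfl⟩
    · rintro ⟨hwz, hws, rfl⟩
      exact ⟨⟨hws, hwz⟩, rfl⟩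
  have hfuture (k : ℕ) : {w | T w ∈ s ∧ w.1 (t (κ (T w))) = z} ∩
        (fun w => w.shift (t (κ (T w)))) ⁻¹' A ∩ (fun w => κ (T w)) ⁻¹' {k} =
      {w | w.1 (t k) = z} ∩ freeze (t k) ⁻¹' (T ⁻¹' (s ∩ κ ⁻¹' {k})) ∩ shift (t k) ⁻¹' A := by
    rw [inter_right_comm, hpast]
    ext w
    refine and_congr_right fun ⟨_, hw⟩ => ?_
    rw [hT.preimage_freeze (hbefore k)] at hw
    simp only [mem_preimage, show κ (T w) = k from hw.2]
  rw [measure_eq_tsum_inter_preimage_singleton _ hκT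
      (hevent.inter (measurable_shift_of_measurable htκT hA)),
    measure_eq_tsum_inter_preimage_singleton _ hκT hevent, ← ENNReal.tsum_mul_right]
  refine tsum_congr fun k => ?_
  rw [hfuture, hpast]
  exact hμ.markov x z (t k) (hT.measurable (hs.inter (hκ (measurableSet_singleton k)))) hA

theorem markov_gridCeil (hμ : IsMarkovLaw p μ) (hT : IsOptionalTime T) (x z : E) (m : ℕ)
    {s : Set ℝ≥0∞} (hs : MeasurableSet s) (hs_top : s ⊆ Iio ⊤) {A : Set (StepPath E)}
    (hA : MeasurableSet A) :
    μ x ({w | T w ∈ s ∧ w.1 (gridCeil m (T w).toNNReal) = z} ∩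
        (fun w => w.shift (gridCeil m (T w).toNNReal)) ⁻¹' A) =
      μ x {w | T w ∈ s ∧ w.1 (gridCeil m (T w).toNNReal) = z} * μ z A := by
  refine hμ.markov_of_countable hT x z (κ := fun τ => ⌊((m : ℝ≥0) + 1) * τ.toNNReal⌋₊)
    (Nat.measurable_floor.comp (ENNReal.measurable_toNNReal.const_mul _))
    (fun k => (k + 1) / (m + 1)) hs (fun τ hτ => ?_) hA
  lift τ to ℝ≥0 using (hs_top hτ).ne
  exact ENNReal.coe_lt_coe.2 (lt_gridCeil m τ)

-- A cylinder sees finitely many coordinates, and by right-continuity these eventually agree for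
-- the path after `gridCeil m T` and the path after `T`.
theorem strongMarkov_pathCylinder (hμ : IsMarkovLaw p μ) (hT : IsOptionalTime T) (x z : E)
    {s : Set ℝ≥0∞} (hs : MeasurableSet s) (hs_top : s ⊆ Iio ⊤) (J : Finset ℝ≥0) (ξ : ℝ≥0 → E) :
    μ x ({w | T w ∈ s ∧ w.1 (T w).toNNReal = z} ∩
        (fun w => w.shift (T w).toNNReal) ⁻¹' pathCylinder J ξ) =
      μ x {w | T w ∈ s ∧ w.1 (T w).toNNReal = z} * μ z (pathCylinder J ξ) := by
  have := hμ.prob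
  have hgrid (m : ℕ) : Measurable fun w => gridCeil m (T w).toNNReal := by
    have := hT.measurable_toNNReal
    unfold gridCeil
    fun_prop
  have hmeas (m : ℕ) : MeasurableSet {w | T w ∈ s ∧ w.1 (gridCeil m (T w).toNNReal) = z} :=
    (hT.measurable hs).inter (measurable_eval (hgrid m) (measurableSet_singleton z))
  have hstate (w : StepPath E) : ∀ᶠ m in atTop,
      w.1 (gridCeil m (T w).toNNReal) = w.1 (T w).toNNReal := by
    simpa only [add_zero] using w.2.eventually_gridCeil_add (T w).toNNReal 0
  have hfuture (w : StepPath E) : ∀ᶠ m in atTop,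
      (w.shift (gridCeil m (T w).toNNReal) ∈ pathCylinder J ξ ↔
        w.shift (T w).toNNReal ∈ pathCylinder J ξ) := by
    filter_upwards [(eventually_all_finset J).2 fun r _ => w.2.eventually_gridCeil_add _ r]
      with m hm
    exact forall₂_congr fun r hr => by rw [shift_apply, shift_apply, hm r hr]
  have hleft := tendsto_measure_of_tendsto_indicator_of_isFiniteMeasure atTop (μ x)
    (A := {w | T w ∈ s ∧ w.1 (T w).toNNReal = z} ∩
        (fun w => w.shift (T w).toNNReal) ⁻¹' pathCylinder J ξ)
    (fun m => (hmeas m).inter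
      (measurable_shift_of_measurable (hgrid m) (measurableSet_pathCylinder J ξ)))
    fun w => by
      filter_upwards [hstate w, hfuture w] with m hm hm'
      simp only [mem_inter_iff, mem_ofPred_eq, mem_preimage, hm, hm']
  have hright := tendsto_measure_of_tendsto_indicator_of_isFiniteMeasure atTop (μ x)
    (A := {w | T w ∈ s ∧ w.1 (T w).toNNReal = z}) hmeas
    fun w => by
      filter_upwards [hstate w] with m hm
      simp only [hm]
  refine tendsto_nhds_unique hleft
    ((ENNReal.Tendsto.mul_const hright (.inr (measure_ne_top (μ z) _))).congr fun m => ?_)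
  exact (hμ.markov_gridCeil hT x z m hs hs_top (measurableSet_pathCylinder J ξ)).symm

theorem strongMarkov (hμ : IsMarkovLaw p μ) (hT : IsOptionalTime T) (x z : E) :
    (((μ x).restrict (stoppedIn T z)).map T).prod (μ z) =
      ((μ x).restrict (stoppedIn T z)).map fun w => (T w, w.shift (T w).toNNReal) := by
  have := hμ.prob
  have hshift := measurable_shift_of_measurable hT.measurable_toNNReal
  refine Measure.prod_eq fun s A hs hA => ?_
  have hevent : T ⁻¹' s ∩ stoppedIn T z =
      {w | T w ∈ s ∩ Iio ⊤ ∧ w.1 (T w).toNNReal = z} := by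
    ext w
    exact and_assoc.symm
  rw [Measure.map_apply (hT.measurable.prodMk hshift) (hs.prod hA),
    Measure.map_apply hT.measurable hs, Measure.restrict_apply (hT.measurable hs),
    Measure.restrict_apply ((hT.measurable.prodMk hshift) (hs.prod hA)), mk_preimage_prod,
    inter_right_comm, hevent]
  exact measure_inter_preimage_eq_mul hshift
    (hμ.strongMarkov_pathCylinder hT x z (hs.inter measurableSet_Iio) inter_subset_right) hA

theorem setIntegral_strongMarkov (hμ : IsMarkovLaw p μ) (hT : IsOptionalTime T) (x z : E)
    {φ : ℝ≥0∞ → ℂ} (hφ : Measurable φ) {F : StepPath E → ℂ} (hF : Measurable F) :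
    ∫ w in stoppedIn T z, φ (T w) * F (w.shift (T w).toNNReal) ∂μ x =
      (∫ w in stoppedIn T z, φ (T w) ∂μ x) * ∫ w, F w ∂μ z := by
  have := hμ.prob
  have hpair := hT.measurable.prodMk (measurable_shift_of_measurable hT.measurable_toNNReal)
  rw [← integral_map hT.measurable.aemeasurable hφ.aestronglyMeasurable, ← integral_prod_mul,
    hμ.strongMarkov hT, integral_map hpair.aemeasurable]
  exact ((hφ.comp measurable_fst).mul (hF.comp measurable_snd)).aestronglyMeasurable

end IsMarkovLaw

/-- The discounted value `e^{-qτ} v` of a payment `v` at time `τ`, read as `0` if `τ = ∞`. -/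
noncomputable def discounted (q : ℂ) (τ : ℝ≥0∞) (v : ℂ) : ℂ :=
  if τ < ⊤ then Complex.exp (-(q * (τ.toReal : ℂ))) * v else 0

section Discounted

variable {q : ℂ}

@[simp] theorem discounted_top (q v : ℂ) : discounted q ⊤ v = 0 := if_neg (lt_irrefl _)

@[simp] theorem discounted_zero (q v : ℂ) : discounted q 0 v = v := by simp [discounted]

theorem discounted_eq_mul (q : ℂ) (τ : ℝ≥0∞) (v : ℂ) :
    discounted q τ v = discounted q τ 1 * v := by
  unfold discounted
  split_ifs <;> ring

theorem discounted_add (q : ℂ) (σ τ : ℝ≥0∞) (v : ℂ) :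
    discounted q (σ + τ) v = discounted q σ (discounted q τ v) := by
  induction σ with
  | top => simp
  | coe σ =>
    induction τ with
    | top => simp [discounted]
    | coe τ =>
      simp only [discounted, ← ENNReal.coe_add, ENNReal.coe_lt_top, if_true, ENNReal.coe_toReal,
        NNReal.coe_add, Complex.ofReal_add, mul_add, neg_add, Complex.exp_add, mul_assoc]

theorem norm_discounted_le (hq : 0 ≤ q.re) (τ : ℝ≥0∞) (v : ℂ) : ‖discounted q τ v‖ ≤ ‖v‖ := by
  unfold discounted
  split_ifs
  · rw [norm_mul, Complex.norm_exp, Complex.neg_re, Complex.re_mul_ofReal]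
    exact mul_le_of_le_one_left (norm_nonneg v)
      (Real.exp_le_one_iff.2 (neg_nonpos.2 (mul_nonneg hq ENNReal.toReal_nonneg)))
  · simp

theorem measurable_discounted {α : Type*} [MeasurableSpace α] {τ : α → ℝ≥0∞} {v : α → ℂ}
    (hτ : Measurable τ) (hv : Measurable v) : Measurable fun ω => discounted q (τ ω) (v ω) := by
  refine Measurable.ite (hτ measurableSet_Iio) ?_ measurable_const
  exact (by fun_prop : Measurable fun ω => Complex.exp (-(q * ((τ ω).toReal : ℂ)))).mul hv

variable {E : Type*} {T : StepPath E → ℝ≥0∞}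

theorem discounted_indicator [DecidableEq E] (z : E) (w : StepPath E) :
    discounted q (T w) (if w.1 (T w).toNNReal = z then 1 else 0) =
      (stoppedIn T z).indicator (fun w => discounted q (T w) 1) w := by
  by_cases hw : T w < ⊤ <;> by_cases hz : w.1 (T w).toNNReal = z <;>
    simp [stoppedIn, indicator, discounted, hw, hz]

theorem discounted_eq_sum_indicator [Fintype E] (F : E → StepPath E → ℂ) (w : StepPath E) :
    discounted q (T w) (F (w.1 (T w).toNNReal) (w.shift (T w).toNNReal)) =
      ∑ z, (stoppedIn T z).indicator
        (fun w => discounted q (T w) 1 * F z (w.shift (T w).toNNReal)) w := by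
  by_cases hw : T w < ⊤
  · rw [Finset.sum_eq_single (w.1 (T w).toNNReal),
      indicator_of_mem (show w ∈ stoppedIn T _ from ⟨hw, rfl⟩), ← discounted_eq_mul]
    · exact fun z _ hz => indicator_of_notMem (fun h => hz h.2.symm) _
    · simp
  · simp [discounted, stoppedIn, hw]

variable [MeasurableSpace E] [MeasurableSingletonClass E] {p : ℝ≥0 → E → E → ℝ}
  {μ : E → Measure (StepPath E)}

theorem IsMarkovLaw.integral_discounted [Fintype E] [DecidableEq E] (hμ : IsMarkovLaw p μ)
    (hq : 0 ≤ q.re) (hT : IsOptionalTime T) (x : E) {F : E → StepPath E → ℂ}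
    (hF : ∀ z, Measurable (F z)) {C : ℝ} (hFC : ∀ z w, ‖F z w‖ ≤ C) :
    ∫ w, discounted q (T w) (F (w.1 (T w).toNNReal) (w.shift (T w).toNNReal)) ∂μ x =
      ∑ z, (∫ w, discounted q (T w) (if w.1 (T w).toNNReal = z then 1 else 0) ∂μ x) *
        ∫ w, F z w ∂μ z := by
  have := hμ.prob
  have hintegrable (z : E) :
      Integrable (fun w => discounted q (T w) 1 * F z (w.shift (T w).toNNReal)) (μ x) := by
    refine Integrable.of_bound (C := C) ?_ (.of_forall fun w => ?_)
    · exact ((measurable_discounted hT.measurable measurable_const).mul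
        ((hF z).comp (measurable_shift_of_measurable hT.measurable_toNNReal))).aestronglyMeasurable
    · rw [← discounted_eq_mul]
      exact (norm_discounted_le hq _ _).trans (hFC z _)
  simp only [discounted_eq_sum_indicator]
  rw [integral_finsetSum _ fun z _ => (hintegrable z).indicator (hT.measurableSet_stoppedIn z)]
  refine Finset.sum_congr rfl fun z _ => ?_
  simp only [discounted_indicator]
  rw [integral_indicator (hT.measurableSet_stoppedIn z),
    integral_indicator (hT.measurableSet_stoppedIn z)]
  exact hμ.setIntegral_strongMarkov hT x z (φ := fun τ => discounted q τ 1)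
    (measurable_discounted measurable_id measurable_const) (hF z)

end Discounted

/-! ### First passage times -/

variable {N : ℕ}

section Window

theorem windowMax_le_iff {w : ℝ≥0 → Fin (N + 1)} {s t : ℝ≥0} {z : Fin (N + 1)} :
    windowMax w s t ≤ z ↔ ∀ u, s ≤ u → u ≤ t → w u ≤ z := by
  simp only [windowMax, iSup_le_iff, mem_Icc, and_imp]

theorem le_windowMax (w : ℝ≥0 → Fin (N + 1)) {s t u : ℝ≥0} (hsu : s ≤ u) (hut : u ≤ t) :
    w u ≤ windowMax w s t := windowMax_le_iff.1 le_rfl u hsu hut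

theorem windowMax_mem_image (w : ℝ≥0 → Fin (N + 1)) {s t : ℝ≥0} (hst : s ≤ t) :
    windowMax w s t ∈ w '' Icc s t := by
  rw [windowMax, ← sSup_image]
  exact ((nonempty_Icc.2 hst).image w).csSup_mem (toFinite _)

theorem windowMax_self (w : ℝ≥0 → Fin (N + 1)) (s : ℝ≥0) : windowMax w s s = w s := by
  simp [windowMax]

theorem windowMax_shift (w : ℝ≥0 → Fin (N + 1)) (T s t : ℝ≥0) :
    windowMax w (T + s) (T + t) = windowMax (fun u => w (T + u)) s t := by
  refine eq_of_forall_ge_iff fun c => ?_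
  simp only [windowMax_le_iff]
  refine ⟨fun h u hsu hut => h _ (by gcongr) (by gcongr), fun h u hsu hut => ?_⟩
  obtain ⟨v, rfl⟩ := exists_add_of_le (le_self_add.trans hsu)
  exact h v (le_of_add_le_add_left hsu) (le_of_add_le_add_left hut)

theorem runMax_le_iff {y z : Fin (N + 1)} {w : ℝ≥0 → Fin (N + 1)} {t : ℝ≥0} :
    runMax y w t ≤ z ↔ y ≤ z ∧ ∀ u ≤ t, w u ≤ z := by
  simp only [runMax, max_le_iff, windowMax_le_iff, zero_le, forall_const]

theorem runMax_zero (y : Fin (N + 1)) (w : ℝ≥0 → Fin (N + 1)) :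
    runMax y w 0 = max y (w 0) := by
  rw [runMax, windowMax_self]

theorem isRightStep_windowMax {w : ℝ≥0 → Fin (N + 1)} (hw : IsRightStep w) (s : ℝ≥0) :
    IsRightStep (windowMax w s) := by
  refine isRightStep_of_exists fun t => ?_
  rcases lt_or_ge t s with hts | hst
  · refine ⟨s, hts, fun r _ hrs => ?_⟩
    simp [windowMax, Icc_eq_empty hrs.not_ge, Icc_eq_empty hts.not_ge]
  · obtain ⟨v, htv, -, hv⟩ := hw.exists_Ico (lt_add_one t)
    refine ⟨v, htv, fun r htr hrv => eq_of_forall_ge_iff fun c => ?_⟩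
    simp only [windowMax_le_iff]
    refine ⟨fun h u hsu hut => h u hsu (hut.trans htr), fun h u hsu hur => ?_⟩
    rcases le_total u t with hut | htu
    · exact h u hsu hut
    · rw [hv u htu (hur.trans_lt hrv)]
      exact h t hst le_rfl

theorem isRightStep_runMax {w : ℝ≥0 → Fin (N + 1)} (hw : IsRightStep w) (y : Fin (N + 1)) :
    IsRightStep (runMax y w) := by
  intro t
  filter_upwards [isRightStep_windowMax hw 0 t] with s hs
  rw [runMax, hs, runMax]

theorem measurable_windowMax (s t : ℝ≥0) :
    Measurable fun w : StepPath (Fin (N + 1)) => windowMax w.1 s t := by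
  rcases lt_or_ge t s with hts | hst
  · simp [windowMax, Icc_eq_empty hts.not_ge]
  -- Right-continuity recovers the values before `t` from a dense set of times, but not that at `t`.
  let d := TopologicalSpace.denseSeq ℝ≥0
  refine measurable_of_Iic fun z => ?_
  have hpreimage : (fun w : StepPath (Fin (N + 1)) => windowMax w.1 s t) ⁻¹' Iic z =
      (fun w => w.1 t) ⁻¹' Iic z ∩
        ⋂ (n : ℕ) (_ : s ≤ d n ∧ d n ≤ t), (fun w => w.1 (d n)) ⁻¹' Iic z := by
    ext w
    simp only [mem_preimage, mem_Iic, mem_inter_iff, mem_iInter, windowMax_le_iff]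
    refine ⟨fun h => ⟨h t hst le_rfl, fun n hn => h _ hn.1 hn.2⟩, fun ⟨ht, hd⟩ u hsu hut => ?_⟩
    rcases hut.eq_or_lt with rfl | hut
    · exact ht
    obtain ⟨v, huv, hvt, hv⟩ := w.2.exists_Ico hut
    obtain ⟨_, ⟨n, rfl⟩, hun, hnv⟩ :=
      (TopologicalSpace.denseRange_denseSeq ℝ≥0).exists_between huv
    rw [← hv _ hun.le hnv]
    exact hd n ⟨hsu.trans hun.le, hnv.le.trans hvt⟩
  rw [hpreimage]
  exact (measurable_coord t measurableSet_Iic).inter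
    (.iInter fun n => .iInter fun _ => measurable_coord _ measurableSet_Iic)

theorem measurable_runMax (y : Fin (N + 1)) (t : ℝ≥0) :
    Measurable fun w : StepPath (Fin (N + 1)) => runMax y w.1 t :=
  measurable_const.max (measurable_windowMax 0 t)

end Window

section TimeInfimum

theorem iInf_time_lt_iff {p : ℝ≥0 → Prop} {c : ℝ≥0∞} :
    (⨅ (t : ℝ≥0) (_ : p t), (t : ℝ≥0∞)) < c ↔ ∃ t, p t ∧ (t : ℝ≥0∞) < c := by
  simp only [iInf_lt_iff, exists_prop]

theorem measurable_iInf_time {α : Type*} [MeasurableSpace α] {p : ℝ≥0 → α → Prop}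
    (hp : ∀ t, MeasurableSet {ω | p t ω}) (hright : ∀ t ω, p t ω → ∀ᶠ s in 𝓝[≥] t, p s ω) :
    Measurable fun ω => ⨅ (t : ℝ≥0) (_ : p t ω), (t : ℝ≥0∞) := by
  let d := TopologicalSpace.denseSeq ℝ≥0
  refine measurable_of_Iio fun c => ?_
  have hpreimage : (fun ω => ⨅ (t : ℝ≥0) (_ : p t ω), (t : ℝ≥0∞)) ⁻¹' Iio c =
      ⋃ (n : ℕ) (_ : (d n : ℝ≥0∞) < c), {ω | p (d n) ω} := by
    ext ω
    simp only [mem_preimage, mem_Iio, iInf_time_lt_iff, mem_iUnion, mem_ofPred_eq, exists_prop]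
    refine ⟨?_, fun ⟨n, hnc, hn⟩ => ⟨_, hn, hnc⟩⟩
    rintro ⟨t, ht, htc⟩
    obtain ⟨r, htr, hrc⟩ := ENNReal.lt_iff_exists_nnreal_btwn.1 htc
    obtain ⟨u, ⟨htu, hur⟩, hu⟩ :=
      (mem_nhdsGE_iff_exists_mem_Ioc_Ico_subset (ENNReal.coe_lt_coe.1 htr)).1 (hright t ω ht)
    obtain ⟨_, ⟨n, rfl⟩, htn, hnu⟩ :=
      (TopologicalSpace.denseRange_denseSeq ℝ≥0).exists_between htu
    exact ⟨n, (ENNReal.coe_lt_coe.2 (hnu.trans_le hur)).trans hrc, hu ⟨htn.le, hnu⟩⟩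
  rw [hpreimage]
  exact .iUnion fun n => .iUnion fun _ => hp (d n)

theorem iInf_time_eq_add {p p' : ℝ≥0 → Prop} {T : ℝ≥0} (hle : ∀ t, p t → T ≤ t)
    (hshift : ∀ s, p (T + s) ↔ p' s) :
    (⨅ (t : ℝ≥0) (_ : p t), (t : ℝ≥0∞)) = T + ⨅ (t : ℝ≥0) (_ : p' t), (t : ℝ≥0∞) := by
  refine eq_of_forall_gt_iff fun c => ?_
  rw [iInf_time_lt_iff, ← lt_tsub_iff_left, iInf_time_lt_iff]
  constructor
  · rintro ⟨t, ht, htc⟩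
    obtain ⟨s, rfl⟩ := exists_add_of_le (hle t ht)
    exact ⟨s, (hshift s).1 ht, lt_tsub_iff_left.2 (by simpa using htc)⟩
  · rintro ⟨s, hs, hsc⟩
    exact ⟨T + s, (hshift s).2 hs, by simpa using lt_tsub_iff_left.1 hsc⟩

end TimeInfimum

section FirstPassage

variable {grid : Fin (N + 1) → ℝ} {S : Set ℝ}

theorem firstPassage_lt_iff {w : ℝ≥0 → Fin (N + 1)} {c : ℝ≥0∞} :
    firstPassage grid S w < c ↔ ∃ t, (0 < t ∧ grid (w t) ∉ S) ∧ (t : ℝ≥0∞) < c :=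
  iInf_time_lt_iff

theorem isOptionalTime_firstPassage (grid : Fin (N + 1) → ℝ) (S : Set ℝ) :
    IsOptionalTime fun w : StepPath (Fin (N + 1)) => firstPassage grid S w.1 where
  measurable := by
    refine measurable_iInf_time (fun t => ?_) fun t w ht => ?_
    · exact (MeasurableSet.const _).inter
        (measurable_coord t (MeasurableSet.of_discrete (s := {z | grid z ∉ S})))
    · filter_upwards [w.2 t, self_mem_nhdsWithin] with s hs hts
      rw [hs]
      exact ⟨ht.1.trans_le hts, ht.2⟩
  lt_iff w s := by
    simp only [firstPassage_lt_iff, freeze_apply, ENNReal.coe_lt_coe]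
    refine exists_congr fun t => and_congr_left fun ht => ?_
    rw [min_eq_left ht.le]

theorem mem_of_lt_firstPassage {w : ℝ≥0 → Fin (N + 1)} (hw : IsRightStep w) {t : ℝ≥0}
    (ht : t < firstPassage grid S w) : grid (w t) ∈ S := by
  by_contra hS
  obtain ⟨r, htr, hrT⟩ := ENNReal.lt_iff_exists_nnreal_btwn.1 ht
  obtain ⟨u, htu, hur, hu⟩ := hw.exists_Ico (ENNReal.coe_lt_coe.1 htr)
  obtain ⟨v, htv, hvu⟩ := exists_between htu
  have hvT : (v : ℝ≥0∞) < firstPassage grid S w :=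
    (ENNReal.coe_lt_coe.2 (hvu.trans_le hur)).trans hrT
  refine lt_irrefl _ (firstPassage_lt_iff.2 ⟨v, ⟨pos_of_gt htv, ?_⟩, hvT⟩)
  rwa [hu v htv.le hvu]

theorem notMem_firstPassage {w : ℝ≥0 → Fin (N + 1)} (hw : IsRightStep w) {T : ℝ≥0}
    (hT : firstPassage grid S w = T) : grid (w T) ∉ S := by
  obtain ⟨u, hTu, -, hu⟩ := hw.exists_Ico (lt_add_one T)
  obtain ⟨t, ht, htu⟩ := firstPassage_lt_iff.1 (hT.trans_lt (ENNReal.coe_lt_coe.2 hTu))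
  have hTt : T ≤ t := ENNReal.coe_le_coe.1 (hT ▸ iInf₂_le t ht)
  rw [← hu t hTt (ENNReal.coe_lt_coe.1 htu)]
  exact ht.2

theorem passagePayoff_const (q : ℂ) (g : Fin (N + 1) → ℂ) (w : ℝ≥0 → Fin (N + 1)) :
    passagePayoff grid S (fun _ => q) g w =
      discounted q (firstPassage grid S w) (g (w (firstPassage grid S w).toNNReal)) := by
  simp only [passagePayoff, discounted, intervalIntegral.integral_const, sub_zero,
    Complex.real_smul, mul_comm]

theorem passagePayoff_indicator_eq_zero {w : ℝ≥0 → Fin (N + 1)} (hw : IsRightStep w)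
    {z : Fin (N + 1)} (hz : grid z ∈ S) (q : ℂ) :
    passagePayoff grid S (fun _ => q) (fun u => if u = z then 1 else 0) w = 0 := by
  rw [passagePayoff_const]
  cases hT : firstPassage grid S w with
  | top => exact discounted_top _ _
  | coe T =>
    have hTz : w T ≠ z := fun h => notMem_firstPassage hw hT (h ▸ hz)
    simp [discounted, hTz]

theorem measurable_passagePayoff (grid : Fin (N + 1) → ℝ) (S : Set ℝ) (q : ℂ)
    (g : Fin (N + 1) → ℂ) :
    Measurable fun w : StepPath (Fin (N + 1)) => passagePayoff grid S (fun _ => q) g w.1 := by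
  have hT := isOptionalTime_firstPassage grid S
  simp only [passagePayoff_const]
  exact measurable_discounted hT.measurable
    ((measurable_of_countable g).comp (measurable_eval hT.measurable_toNNReal))

theorem norm_passagePayoff_le {q : ℂ} (hq : 0 ≤ q.re) (S : Set ℝ) (g : Fin (N + 1) → ℂ)
    (w : ℝ≥0 → Fin (N + 1)) : ‖passagePayoff grid S (fun _ => q) g w‖ ≤ ‖g‖ := by
  rw [passagePayoff_const]
  exact (norm_discounted_le hq _ _).trans (norm_le_pi_norm g _)

end FirstPassage

/-! ### Drawdown times -/

section Drawdown

variable {grid : Fin (N + 1) → ℝ} {a : ℝ} {y y' : Fin (N + 1)} {w : ℝ≥0 → Fin (N + 1)}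

theorem monotone_drawdownTime : Monotone (drawdownTime grid a y w) :=
  monotone_nat_of_le_succ fun _ => le_iInf₂ fun _ ht => ht.1.le

theorem measurable_drawdownTime (grid : Fin (N + 1) → ℝ) (a : ℝ) (y : Fin (N + 1)) (n : ℕ) :
    Measurable fun w : StepPath (Fin (N + 1)) => drawdownTime grid a y w.1 n := by
  induction n with
  | zero => exact measurable_const
  | succ n ih =>
    have hτ := ih.ennreal_toNNReal
    refine measurable_iInf_time (fun t => ?_) fun t w ht => ?_
    · have hdrawdown : MeasurableSet {w : StepPath (Fin (N + 1)) |
          a ≤ grid (runMax y w.1 t) - grid (w.1 t)} :=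
        (measurable_runMax y t).prodMk (measurable_coord t) (MeasurableSet.of_discrete
          (s := {p : Fin (N + 1) × Fin (N + 1) | a ≤ grid p.1 - grid p.2}))
      have hrecovery : MeasurableSet {w : StepPath (Fin (N + 1)) |
          runMax y w.1 (drawdownTime grid a y w.1 n).toNNReal ≤
            windowMax (w.shift (drawdownTime grid a y w.1 n).toNNReal).1 0
              (t - (drawdownTime grid a y w.1 n).toNNReal)} := by
        refine measurableSet_le
          (IsRightStep.measurable_eval (measurable_runMax y) (isRightStep_runMax ·.2 y) hτ) ?_
        exact IsRightStep.measurable_eval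
          (fun s => (measurable_windowMax 0 s).comp (measurable_shift_of_measurable hτ))
          (fun w => isRightStep_windowMax (w.shift _).2 0) (hτ.const_sub t)
      convert (measurableSet_lt ih (measurable_const (a := (t : ℝ≥0∞)))).inter
        (hdrawdown.inter hrecovery) using 1
      ext w
      refine and_congr_right fun hlt => and_congr_right fun _ => ?_
      have hle : (drawdownTime grid a y w.1 n).toNNReal ≤ t := by
        simpa using ENNReal.toNNReal_mono ENNReal.coe_ne_top hlt.le
      have hwindow := windowMax_shift w.1 (drawdownTime grid a y w.1 n).toNNReal 0
        (t - (drawdownTime grid a y w.1 n).toNNReal)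
      rw [add_zero, add_tsub_cancel_of_le hle] at hwindow
      rw [hwindow]
      rfl
    · filter_upwards [w.2 t, isRightStep_runMax w.2 y t,
        isRightStep_windowMax w.2 (drawdownTime grid a y w.1 n).toNNReal t,
        self_mem_nhdsWithin] with s hs hrun hwindow hts
      rw [hs, hrun, hwindow]
      exact ⟨ht.1.trans_le (ENNReal.coe_le_coe.2 hts), ht.2⟩

theorem drawdownPayoff_eq_discounted (f : Fin (N + 1) → Fin (N + 1) → ℂ) (n : ℕ) (q : ℂ)
    (y : Fin (N + 1)) (w : ℝ≥0 → Fin (N + 1)) :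
    drawdownPayoff grid a f n q y w = discounted q (drawdownTime grid a y w n)
      (f (w (drawdownTime grid a y w n).toNNReal)
        (runMax y w (drawdownTime grid a y w n).toNNReal)) := rfl

theorem measurable_drawdownPayoff (grid : Fin (N + 1) → ℝ) (a : ℝ)
    (f : Fin (N + 1) → Fin (N + 1) → ℂ) (n : ℕ) (q : ℂ) (y : Fin (N + 1)) :
    Measurable fun w : StepPath (Fin (N + 1)) => drawdownPayoff grid a f n q y w.1 := by
  have hτ := measurable_drawdownTime grid a y n
  have hrun := IsRightStep.measurable_eval (measurable_runMax y) (isRightStep_runMax ·.2 y)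
    hτ.ennreal_toNNReal
  exact measurable_discounted hτ
    ((measurable_of_countable fun p : Fin (N + 1) × Fin (N + 1) => f p.1 p.2).comp
      ((measurable_eval hτ.ennreal_toNNReal).prodMk hrun))

theorem norm_drawdownPayoff_le {q : ℂ} (hq : 0 ≤ q.re) (f : Fin (N + 1) → Fin (N + 1) → ℂ)
    (n : ℕ) (y : Fin (N + 1)) (w : ℝ≥0 → Fin (N + 1)) :
    ‖drawdownPayoff grid a f n q y w‖ ≤ ‖f‖ :=
  (norm_discounted_le hq _ _).trans ((norm_le_pi_norm (f _) _).trans (norm_le_pi_norm f _))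

theorem drawdownPayoff_zero (f : Fin (N + 1) → Fin (N + 1) → ℂ) (q : ℂ) (y : Fin (N + 1))
    (w : ℝ≥0 → Fin (N + 1)) : drawdownPayoff grid a f 0 q y w = f (w 0) (max y (w 0)) := by
  simp [drawdownPayoff_eq_discounted, drawdownTime, runMax_zero]

theorem runMax_add {T : ℝ≥0} (hpre : ∀ u < T, w u ≤ y) (hyy' : y ≤ y') (hy' : y' ≤ max y (w T))
    (s : ℝ≥0) : runMax y w (T + s) = runMax y' (fun u => w (T + u)) s := by
  refine eq_of_forall_ge_iff fun c => ?_
  simp only [runMax_le_iff]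
  constructor
  · rintro ⟨hy, hw⟩
    exact ⟨hy'.trans (max_le hy (hw T le_self_add)), fun u hu => hw _ (by gcongr)⟩
  · rintro ⟨hy, hw⟩
    refine ⟨hyy'.trans hy, fun u hu => ?_⟩
    rcases lt_or_ge u T with huT | hTu
    · exact (hpre u huT).trans (hyy'.trans hy)
    · obtain ⟨v, rfl⟩ := exists_add_of_le hTu
      exact hw v (le_of_add_le_add_left hu)

theorem drawdownTime_add_of_renewal {T : ℝ≥0} {m n : ℕ}
    (hrun : ∀ s, runMax y w (T + s) = runMax y' (fun u => w (T + u)) s)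
    (hτ : drawdownTime grid a y w n = T + drawdownTime grid a y' (fun u => w (T + u)) m) (k : ℕ) :
    drawdownTime grid a y w (n + k) =
      T + drawdownTime grid a y' (fun u => w (T + u)) (m + k) := by
  induction k with
  | zero => exact hτ
  | succ k ih =>
    rw [← add_assoc, ← add_assoc]
    cases hσ : drawdownTime grid a y' (fun u => w (T + u)) (m + k) with
    | top =>
      rw [hσ, add_top] at ih
      rw [top_le_iff.1 (ih.symm.trans_le (monotone_drawdownTime (n + k).le_succ)),
        top_le_iff.1 (hσ.symm.trans_le (monotone_drawdownTime (m + k).le_succ)), add_top]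
    | coe σ =>
      rw [drawdownTime, drawdownTime, ih, hσ, ← ENNReal.coe_add, ENNReal.toNNReal_coe,
        ENNReal.toNNReal_coe]
      refine iInf_time_eq_add (fun t ht => ?_) fun s => ?_
      · exact le_self_add.trans (ENNReal.coe_lt_coe.1 ht.1).le
      · rw [hrun, hrun, windowMax_shift, ENNReal.coe_lt_coe, ENNReal.coe_lt_coe,
          add_lt_add_iff_left]

theorem drawdownPayoff_of_renewal {T : ℝ≥0} {m n : ℕ}
    (hrun : ∀ s, runMax y w (T + s) = runMax y' (fun u => w (T + u)) s)
    (hτ : drawdownTime grid a y w n = T + drawdownTime grid a y' (fun u => w (T + u)) m)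
    (f : Fin (N + 1) → Fin (N + 1) → ℂ) (q : ℂ) :
    drawdownPayoff grid a f n q y w =
      discounted q T (drawdownPayoff grid a f m q y' fun u => w (T + u)) := by
  rw [drawdownPayoff_eq_discounted, drawdownPayoff_eq_discounted, ← discounted_add, hτ]
  cases drawdownTime grid a y' (fun u => w (T + u)) m with
  | top => simp only [add_top, discounted_top]
  | coe σ => rw [← ENNReal.coe_add, ENNReal.toNNReal_coe, ENNReal.toNNReal_coe, hrun]

theorem drawdownTime_one (hw : w 0 ≤ y) :
    drawdownTime grid a y w 1 = ⨅ (t : ℝ≥0) (_ : 0 < t ∧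
      a ≤ grid (runMax y w t) - grid (w t) ∧ y ≤ windowMax w 0 t), (t : ℝ≥0∞) := by
  simp only [drawdownTime, ENNReal.toNNReal_zero, runMax_zero, max_eq_left hw, ENNReal.coe_pos]

section Renewal

variable {T : ℝ≥0} {n : ℕ}

theorem drawdownTime_one_eq_add_of_up (ha : 0 < a) (hw : w 0 ≤ y) (hpre : ∀ u < T, w u ≤ y)
    (hT : y ≤ w T) (hle : T ≤ drawdownTime grid a y w 1) :
    drawdownTime grid a y w 1 = T + drawdownTime grid a (w T) (fun u => w (T + u)) 1 := by
  rw [drawdownTime_one hw] at hle ⊢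
  rw [drawdownTime_one (by rw [add_zero])]
  refine iInf_time_eq_add (fun t ht => ENNReal.coe_le_coe.1 (hle.trans (iInf₂_le t ht)))
    fun s => ?_
  have hwindow : y ≤ windowMax w 0 (T + s) := hT.trans (le_windowMax w zero_le le_self_add)
  have hwindow' : w T ≤ windowMax (fun u => w (T + u)) 0 s := by
    simpa using le_windowMax (fun u => w (T + u)) le_rfl (zero_le (a := s))
  have hs_pos (hd : a ≤ grid (runMax (w T) (fun u => w (T + u)) s) - grid (w (T + s))) :
      0 < s := by
    rw [pos_iff_ne_zero]
    rintro rfl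
    rw [runMax_zero, add_zero, max_self, sub_self] at hd
    exact ha.not_ge hd
  rw [runMax_add hpre hT (le_max_right y (w T))]
  simp only [hwindow, hwindow', and_true]
  exact ⟨fun h => ⟨hs_pos h.2, h.2⟩, fun h => ⟨h.1.trans_le le_add_self, h.2⟩⟩

theorem drawdownPayoff_eq_discounted_of_up (ha : 0 < a) (hw : w 0 ≤ y)
    (hpre : ∀ u < T, w u ≤ y) (hT : y ≤ w T) (hle : T ≤ drawdownTime grid a y w 1)
    (f : Fin (N + 1) → Fin (N + 1) → ℂ) (q : ℂ) :
    drawdownPayoff grid a f (n + 1) q y w =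
      discounted q T (drawdownPayoff grid a f (n + 1) q (w T) fun u => w (T + u)) := by
  have hrun := runMax_add hpre hT (le_max_right y (w T))
  have hτ := drawdownTime_one_eq_add_of_up ha hw hpre hT hle
  refine drawdownPayoff_of_renewal hrun ?_ f q
  simpa only [add_comm 1 n] using drawdownTime_add_of_renewal hrun hτ n

theorem drawdownTime_one_eq_of_down (ha : 0 < a) (hw : w 0 = y) (hpre : ∀ u < T, w u ≤ y)
    (hTy : w T ≤ y) (hT : grid (w T) ≤ grid y - a) (hle : T ≤ drawdownTime grid a y w 1) :
    drawdownTime grid a y w 1 = T := by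
  refine le_antisymm ?_ hle
  have hT_pos : 0 < T := by
    rw [pos_iff_ne_zero]
    rintro rfl
    rw [hw] at hT
    linarith
  have hrun : runMax y w T = y :=
    le_antisymm (runMax_le_iff.2 ⟨le_rfl, fun u hu => hu.lt_or_eq.elim (hpre u) (· ▸ hTy)⟩)
      (le_max_left _ _)
  rw [drawdownTime_one hw.le]
  refine iInf₂_le T ⟨hT_pos, ?_, ?_⟩
  · rw [hrun]
    linarith
  · exact hw ▸ le_windowMax w le_rfl zero_le

theorem drawdownPayoff_eq_discounted_of_down (ha : 0 < a) (hw : w 0 = y)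
    (hpre : ∀ u < T, w u ≤ y) (hTy : w T ≤ y) (hT : grid (w T) ≤ grid y - a)
    (hle : T ≤ drawdownTime grid a y w 1) (f : Fin (N + 1) → Fin (N + 1) → ℂ) (q : ℂ) :
    drawdownPayoff grid a f (n + 1) q y w =
      discounted q T (drawdownPayoff grid a f n q y fun u => w (T + u)) := by
  have hrun := runMax_add hpre le_rfl (le_max_left y (w T))
  have hτ : drawdownTime grid a y w 1 =
      T + drawdownTime grid a y (fun u => w (T + u)) 0 := by
    rw [drawdownTime_one_eq_of_down ha hw hpre hTy hT hle, drawdownTime, add_zero]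
  refine drawdownPayoff_of_renewal hrun ?_ f q
  simpa only [add_comm 1 n, zero_add] using drawdownTime_add_of_renewal hrun hτ n

theorem drawdownPayoff_succ_eq_zero (hle : ⊤ ≤ drawdownTime grid a y w 1)
    (f : Fin (N + 1) → Fin (N + 1) → ℂ) (q : ℂ) :
    drawdownPayoff grid a f (n + 1) q y w = 0 := by
  rw [drawdownPayoff_eq_discounted,
    top_le_iff.1 (hle.trans (monotone_drawdownTime (Nat.le_add_left 1 n))), discounted_top]

end Renewal

section FirstExit

theorem firstPassage_Iio_le_drawdownTime_one (hgrid : StrictMono grid) (hw : IsRightStep w)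
    (hw₀ : w 0 ≤ y) : firstPassage grid (Iio (grid y)) w ≤ drawdownTime grid a y w 1 := by
  rw [drawdownTime_one hw₀]
  refine le_iInf₂ fun t ht => not_lt.1 fun hlt => ?_
  obtain ⟨u, hu, hmax⟩ := windowMax_mem_image w (zero_le (a := t))
  have huy : w u < y := hgrid.lt_iff_lt.1
    (mem_of_lt_firstPassage hw ((ENNReal.coe_le_coe.2 hu.2).trans_lt hlt))
  exact huy.not_ge (hmax ▸ ht.2.2)

theorem firstPassage_Ioc_le_drawdownTime_one (hgrid : StrictMono grid) (hw : IsRightStep w)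
    (hw₀ : w 0 ≤ y) :
    firstPassage grid (Ioc (grid y - a) (grid y)) w ≤ drawdownTime grid a y w 1 := by
  rw [drawdownTime_one hw₀]
  refine le_iInf₂ fun t ht => not_lt.1 fun hlt => ?_
  have hmem {u : ℝ≥0} (hu : u ≤ t) : grid (w u) ∈ Ioc (grid y - a) (grid y) :=
    mem_of_lt_firstPassage hw ((ENNReal.coe_le_coe.2 hu).trans_lt hlt)
  have hrun : runMax y w t = y :=
    le_antisymm (runMax_le_iff.2 ⟨le_rfl, fun u hu => hgrid.le_iff_le.1 (hmem hu).2⟩)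
      (le_max_left _ _)
  have hdrawdown := ht.2.1
  rw [hrun] at hdrawdown
  linarith [(hmem le_rfl).1]

theorem drawdownPayoff_eq_discounted_Iio (hgrid : StrictMono grid) (ha : 0 < a)
    (f : Fin (N + 1) → Fin (N + 1) → ℂ) (n : ℕ) (q : ℂ) (w : StepPath (Fin (N + 1)))
    (hw : w.1 0 ≤ y) :
    drawdownPayoff grid a f (n + 1) q y w.1 =
      discounted q (firstPassage grid (Iio (grid y)) w.1)
        (drawdownPayoff grid a f (n + 1) q
          (w.1 (firstPassage grid (Iio (grid y)) w.1).toNNReal)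
          (w.shift (firstPassage grid (Iio (grid y)) w.1).toNNReal).1) := by
  have hle := firstPassage_Iio_le_drawdownTime_one (a := a) hgrid w.2 hw
  cases hT : firstPassage grid (Iio (grid y)) w.1 with
  | top => rw [discounted_top, drawdownPayoff_succ_eq_zero (hT ▸ hle)]
  | coe T =>
    have hpre (u) (hu : u < T) : w.1 u ≤ y := by
      have hmem := mem_of_lt_firstPassage w.2 ((ENNReal.coe_lt_coe.2 hu).trans_eq hT.symm)
      exact (hgrid.lt_iff_lt.1 hmem).le
    have hyT : y ≤ w.1 T := hgrid.le_iff_le.1 (not_lt.1 (notMem_firstPassage w.2 hT))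
    exact drawdownPayoff_eq_discounted_of_up ha hw hpre hyT (hT ▸ hle) f q

theorem drawdownPayoff_eq_discounted_Ioc (hgrid : StrictMono grid) (ha : 0 < a)
    (f : Fin (N + 1) → Fin (N + 1) → ℂ) (n : ℕ) (q : ℂ) (w : StepPath (Fin (N + 1)))
    (hw : w.1 0 = y) :
    drawdownPayoff grid a f (n + 1) q y w.1 =
      discounted q (firstPassage grid (Ioc (grid y - a) (grid y)) w.1)
        (if y < w.1 (firstPassage grid (Ioc (grid y - a) (grid y)) w.1).toNNReal then
          drawdownPayoff grid a f (n + 1) q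
            (w.1 (firstPassage grid (Ioc (grid y - a) (grid y)) w.1).toNNReal)
            (w.shift (firstPassage grid (Ioc (grid y - a) (grid y)) w.1).toNNReal).1
        else drawdownPayoff grid a f n q y
          (w.shift (firstPassage grid (Ioc (grid y - a) (grid y)) w.1).toNNReal).1) := by
  have hle := firstPassage_Ioc_le_drawdownTime_one (a := a) hgrid w.2 hw.le
  cases hT : firstPassage grid (Ioc (grid y - a) (grid y)) w.1 with
  | top => rw [discounted_top, drawdownPayoff_succ_eq_zero (hT ▸ hle)]
  | coe T =>
    have hpre (u) (hu : u < T) : w.1 u ≤ y := hgrid.le_iff_le.1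
      (mem_of_lt_firstPassage w.2 ((ENNReal.coe_lt_coe.2 hu).trans_eq hT.symm)).2
    rw [hT] at hle
    rw [ENNReal.toNNReal_coe]
    split_ifs with hyT
    · exact drawdownPayoff_eq_discounted_of_up ha hw.le hpre hyT.le hle f q
    · have hTy : w.1 T ≤ y := not_lt.1 hyT
      have hdown : grid (w.1 T) ≤ grid y - a := not_lt.1 fun h =>
        notMem_firstPassage w.2 hT ⟨h, hgrid.monotone hTy⟩
      exact drawdownPayoff_eq_discounted_of_down ha hw hpre hTy hdown hle f q

end FirstExit

end Drawdown

/-! ### The linear system -/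

section Chain

variable {G : Matrix (Fin (N + 1)) (Fin (N + 1)) ℝ} {Ω : Type*} [MeasurableSpace Ω]
  {P : Fin (N + 1) → Measure Ω} {Y : ℝ≥0 → Ω → Fin (N + 1)}

namespace IsCTMC

/-- The trajectory of a continuous-time Markov chain as a random element of path space. -/
def path (hY : IsCTMC G P Y) (ω : Ω) : StepPath (Fin (N + 1)) :=
  ⟨fun t => Y t ω, isRightStep_of_continuousWithinAt (hY.right_cont ω)⟩

variable (hY : IsCTMC G P Y)
include hY

theorem measurable_path : Measurable hY.path := measurable_of_coord hY.meas

theorem ae_start (x : Fin (N + 1)) : ∀ᵐ ω ∂P x, Y 0 ω = x := by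
  have := hY.prob x
  have hmeas : MeasurableSet {ω | Y 0 ω = x} := hY.meas 0 (measurableSet_singleton x)
  have hfdd := hY.fdd x 0 (fun _ => 0) (fun _ => x) rfl monotone_const
  refine (prob_compl_eq_zero_iff hmeas).2 ?_
  simpa [Measure.real, ENNReal.toReal_eq_one_iff] using hfdd

theorem isMarkovLaw :
    IsMarkovLaw (fun t x z => NormedSpace.exp ((t : ℝ) • G) x z)
      fun x => (P x).map hY.path where
  prob x :=
    have := hY.prob x
    Measure.isProbabilityMeasure_map hY.measurable_path.aemeasurable
  fdd x n t z ht := by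
    let t' : ℕ → ℝ≥0 := fun i => i.casesOn 0 t
    let z' : ℕ → Fin (N + 1) := fun i => i.casesOn x z
    have t'_mono : Monotone t' := monotone_nat_of_le_succ fun
      | 0 => zero_le
      | i + 1 => ht i.le_succ
    have hmeas : MeasurableSet {w : StepPath (Fin (N + 1)) | ∀ i ≤ n, w.1 (t i) = z i} := by
      have hinter : {w : StepPath (Fin (N + 1)) | ∀ i ≤ n, w.1 (t i) = z i} =
          ⋂ (i) (_ : i ≤ n), (fun w => w.1 (t i)) ⁻¹' {z i} := by
        ext w; simp
      rw [hinter]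
      exact .iInter fun i => .iInter fun _ => measurable_coord _ (measurableSet_singleton _)
    have hevent : hY.path ⁻¹' {w | ∀ i ≤ n, w.1 (t i) = z i} =ᵐ[P x]
        {ω | ∀ i ≤ n + 1, Y (t' i) ω = z' i} := by
      filter_upwards [hY.ae_start x] with ω hω
      refine propext ⟨fun h i hi => ?_, fun h i hi => h (i + 1) (by gcongr)⟩
      cases i with
      | zero => exact hω
      | succ i => exact h i (Nat.le_of_succ_le_succ hi)
    rw [map_measureReal_apply hY.measurable_path hmeas, measureReal_congr hevent,
      hY.fdd x (n + 1) t' z' rfl t'_mono, Finset.prod_range_succ', mul_comm (∏ _ ∈ _, _)]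
    simp [t', z', NNReal.coe_sub (ht (Nat.le_succ _))]

theorem integral_eq_sum_passage {grid : Fin (N + 1) → ℝ} {S : Set ℝ} {q : ℂ} (hq : 0 ≤ q.re)
    {x : Fin (N + 1)} {Ψ : StepPath (Fin (N + 1)) → ℂ}
    {F : Fin (N + 1) → StepPath (Fin (N + 1)) → ℂ}
    (hF : ∀ z, Measurable (F z)) {C : ℝ} (hFC : ∀ z w, ‖F z w‖ ≤ C)
    (hΨ : ∀ w : StepPath (Fin (N + 1)), w.1 0 = x → Ψ w = discounted q (firstPassage grid S w.1)
      (F (w.1 (firstPassage grid S w.1).toNNReal) (w.shift (firstPassage grid S w.1).toNNReal))) :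
    ∫ ω, Ψ (hY.path ω) ∂P x =
      ∑ z, passage grid P Y S (fun _ => q) x (fun u => if u = z then 1 else 0) *
        ∫ ω, F z (hY.path ω) ∂P z := by
  have hT := isOptionalTime_firstPassage grid S
  have hpath (z) := hY.measurable_path.aemeasurable (μ := P z)
  have hvalue : Measurable fun w : StepPath (Fin (N + 1)) =>
      F (w.1 (firstPassage grid S w.1).toNNReal) (w.shift (firstPassage grid S w.1).toNNReal) :=
    measurable_comp_countable
      (fun z => (hF z).comp (measurable_shift_of_measurable hT.measurable_toNNReal))
      (measurable_eval hT.measurable_toNNReal)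
  calc ∫ ω, Ψ (hY.path ω) ∂P x
    _ = ∫ w, discounted q (firstPassage grid S w.1)
          (F (w.1 (firstPassage grid S w.1).toNNReal)
            (w.shift (firstPassage grid S w.1).toNNReal)) ∂(P x).map hY.path := by
      rw [integral_map (hpath x) (measurable_discounted hT.measurable hvalue).aestronglyMeasurable]
      exact integral_congr_ae ((hY.ae_start x).mono fun ω hω => hΨ _ hω)
    _ = ∑ z, (∫ w, passagePayoff grid S (fun _ => q) (fun u => if u = z then 1 else 0) w.1
          ∂(P x).map hY.path) * ∫ w, F z w ∂(P z).map hY.path := by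
      simp only [passagePayoff_const]
      exact hY.isMarkovLaw.integral_discounted hq hT x hF hFC
    _ = ∑ z, passage grid P Y S (fun _ => q) x (fun u => if u = z then 1 else 0) *
          ∫ ω, F z (hY.path ω) ∂P z := by
      refine Finset.sum_congr rfl fun z _ => ?_
      rw [integral_map (hpath z) (hF z).aestronglyMeasurable, integral_map (hpath x)
        (measurable_passagePayoff grid S q _).aestronglyMeasurable]
      rfl

variable {grid : Fin (N + 1) → ℝ} {a : ℝ} {q : ℂ}

theorem integrable_passagePayoff (hq : 0 ≤ q.re) (S : Set ℝ) (g : Fin (N + 1) → ℂ)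
    (x : Fin (N + 1)) :
    Integrable (fun ω => passagePayoff grid S (fun _ => q) g fun t => Y t ω) (P x) := by
  have := hY.prob x
  exact Integrable.of_bound
    ((measurable_passagePayoff grid S q g).comp hY.measurable_path).aestronglyMeasurable ‖g‖
    (.of_forall fun _ => norm_passagePayoff_le hq S g _)

theorem integrable_drawdownPayoff (hq : 0 ≤ q.re) (f : Fin (N + 1) → Fin (N + 1) → ℂ) (n : ℕ)
    (x y : Fin (N + 1)) :
    Integrable (fun ω => drawdownPayoff grid a f n q y fun t => Y t ω) (P x) := by
  have := hY.prob x
  exact Integrable.of_bound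
    ((measurable_drawdownPayoff grid a f n q y).comp hY.measurable_path).aestronglyMeasurable ‖f‖
    (.of_forall fun _ => norm_drawdownPayoff_le hq f n y _)

theorem passage_indicator_eq_zero {S : Set ℝ} {z : Fin (N + 1)} (hz : grid z ∈ S)
    (x : Fin (N + 1)) :
    passage grid P Y S (fun _ => q) x (fun u => if u = z then 1 else 0) = 0 :=
  integral_eq_zero_of_ae (.of_forall fun ω =>
    passagePayoff_indicator_eq_zero (hY.path ω).2 hz q)

theorem passage_eq_sum (hq : 0 ≤ q.re) (S : Set ℝ) (x : Fin (N + 1)) (g : Fin (N + 1) → ℂ) :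
    passage grid P Y S (fun _ => q) x g =
      ∑ z, passage grid P Y S (fun _ => q) x (fun u => if u = z then 1 else 0) * g z := by
  have := hY.prob
  have h := hY.integral_eq_sum_passage hq (x := x) (F := fun z _ => g z)
    (Ψ := fun w => passagePayoff grid S (fun _ => q) g w.1) (fun _ => measurable_const)
    (fun z _ => norm_le_pi_norm g z) fun w _ => passagePayoff_const q g w.1
  simp only [integral_const, probReal_univ, one_smul] at h
  exact h

theorem J_eq_sum (hgrid : StrictMono grid) (ha : 0 < a) (hq : 0 ≤ q.re)
    (f : Fin (N + 1) → Fin (N + 1) → ℂ) (n : ℕ) {x y : Fin (N + 1)} (hxy : x ≤ y) :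
    J grid P Y a f (n + 1) q x y =
      ∑ z ∈ Finset.univ.filter (fun z => y ≤ z),
        passage grid P Y (Iio (grid y)) (fun _ => q) x (fun u => if u = z then 1 else 0) *
          J grid P Y a f (n + 1) q z z := by
  rw [Finset.sum_filter_of_ne fun z _ hz => ?_]
  · exact hY.integral_eq_sum_passage hq
      (F := fun z w => drawdownPayoff grid a f (n + 1) q z w.1)
      (Ψ := fun w => drawdownPayoff grid a f (n + 1) q y w.1)
      (measurable_drawdownPayoff grid a f (n + 1) q)
      (fun z w => norm_drawdownPayoff_le hq f (n + 1) z w.1)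
      fun w hw => drawdownPayoff_eq_discounted_Iio hgrid ha f n q w (hw.trans_le hxy)
  · contrapose! hz
    have hzy : grid z ∈ Iio (grid y) := hgrid hz
    rw [hY.passage_indicator_eq_zero hzy, zero_mul]

theorem J_self_eq_passage_add_sum (hgrid : StrictMono grid) (ha : 0 < a) (hq : 0 ≤ q.re)
    (f : Fin (N + 1) → Fin (N + 1) → ℂ) (n : ℕ) (y : Fin (N + 1)) :
    J grid P Y a f (n + 1) q y y =
      passage grid P Y (Ioc (grid y - a) (grid y)) (fun _ => q) y
          (fun u => J grid P Y a f n q u y * (if grid u ≤ grid y - a then 1 else 0)) +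
        ∑ z ∈ Finset.univ.filter (fun z => y < z),
          passage grid P Y (Ioc (grid y - a) (grid y)) (fun _ => q) y
            (fun u => if u = z then 1 else 0) * J grid P Y a f (n + 1) q z z := by
  let F (z : Fin (N + 1)) (w : StepPath (Fin (N + 1))) : ℂ :=
    if y < z then drawdownPayoff grid a f (n + 1) q z w.1 else drawdownPayoff grid a f n q y w.1
  have hF (z) : Measurable (F z) := Measurable.ite (.const _)
    (measurable_drawdownPayoff grid a f (n + 1) q z) (measurable_drawdownPayoff grid a f n q y)
  have hFC (z w) : ‖F z w‖ ≤ ‖f‖ := by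
    dsimp only [F]
    split_ifs <;> exact norm_drawdownPayoff_le hq f _ _ w.1
  have hrenewal : J grid P Y a f (n + 1) q y y = ∑ z,
      passage grid P Y (Ioc (grid y - a) (grid y)) (fun _ => q) y
        (fun u => if u = z then 1 else 0) * ∫ ω, F z (hY.path ω) ∂P z :=
    hY.integral_eq_sum_passage hq (Ψ := fun w => drawdownPayoff grid a f (n + 1) q y w.1) hF hFC
      (drawdownPayoff_eq_discounted_Ioc hgrid ha f n q)
  rw [hrenewal, hY.passage_eq_sum hq, Finset.sum_filter, ← Finset.sum_add_distrib]
  refine Finset.sum_congr rfl fun z _ => ?_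
  rcases lt_or_ge y z with hyz | hzy
  · have habove : ¬grid z ≤ grid y - a := by linarith [hgrid hyz]
    simp only [F, if_pos hyz, if_neg habove, mul_zero, zero_add]
    rfl
  · rcases le_or_gt (grid z) (grid y - a) with hdown | hinside
    · simp only [F, if_neg hzy.not_gt, if_pos hdown, mul_one, add_zero]
      rfl
    · have hmem : grid z ∈ Ioc (grid y - a) (grid y) := ⟨hinside, hgrid.monotone hzy⟩
      rw [hY.passage_indicator_eq_zero hmem]
      simp only [zero_mul, ite_self, add_zero]

theorem J_zero (f : Fin (N + 1) → Fin (N + 1) → ℂ) {x y : Fin (N + 1)} (hxy : x ≤ y) :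
    J grid P Y a f 0 q x y = f x y := by
  have := hY.prob x
  have hstart : ∀ᵐ ω ∂P x, drawdownPayoff grid a f 0 q y (fun t => Y t ω) = f x y := by
    filter_upwards [hY.ae_start x] with ω hω
    rw [drawdownPayoff_zero, hω, max_eq_left hxy]
  rw [J, integral_congr_ae hstart, integral_const, probReal_univ, one_smul]

end IsCTMC

end Chain

end CTMCDrawdown

open CTMCDrawdown Set in
theorem mainTheorem6_general {N : ℕ} (grid : Fin (N + 1) → ℝ) (hgrid : StrictMono grid)
    (G : Matrix (Fin (N + 1)) (Fin (N + 1)) ℝ)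
    {Ω : Type*} [MeasurableSpace Ω] (P : Fin (N + 1) → Measure Ω)
    (Y : ℝ≥0 → Ω → Fin (N + 1)) (hY : IsCTMC G P Y)
    (a : ℝ) (ha : 0 < a) (f : Fin (N + 1) → Fin (N + 1) → ℂ)
    (q : ℂ) (hq : 0 ≤ q.re) :
    (∀ (S : Set ℝ) (g : Fin (N + 1) → ℂ) (x : Fin (N + 1)),
      Integrable (fun ω => passagePayoff grid S (fun _ => q) g (fun t => Y t ω)) (P x)) ∧
    (∀ (n : ℕ) (x y : Fin (N + 1)),
      Integrable (fun ω => drawdownPayoff grid a f n q y (fun t => Y t ω)) (P x)) ∧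
    (∀ n : ℕ, 1 ≤ n → ∀ x y : Fin (N + 1), x ≤ y →
      J grid P Y a f n q x y =
        ∑ z ∈ Finset.univ.filter (fun z => y ≤ z),
          passage grid P Y (Iio (grid y)) (fun _ => q) x
            (fun u => if u = z then 1 else 0) *
          J grid P Y a f n q z z) ∧
    (∀ n : ℕ, 1 ≤ n → ∀ y : Fin (N + 1),
      J grid P Y a f n q y y =
        passage grid P Y (Ioc (grid y - a) (grid y)) (fun _ => q) y
          (fun u => J grid P Y a f (n - 1) q u y *
            (if grid u ≤ grid y - a then 1 else 0)) +
        ∑ z ∈ Finset.univ.filter (fun z => y < z),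
          passage grid P Y (Ioc (grid y - a) (grid y)) (fun _ => q) y
            (fun u => if u = z then 1 else 0) *
          J grid P Y a f n q z z) ∧
    (∀ x y : Fin (N + 1), x ≤ y → J grid P Y a f 0 q x y = f x y) := by
  refine ⟨fun S g x => hY.integrable_passagePayoff hq S g x,
    fun n x y => hY.integrable_drawdownPayoff hq f n x y, fun n hn x y hxy => ?_,
    fun n hn y => ?_, fun x y hxy => hY.J_zero f hxy⟩
  · obtain ⟨n, rfl⟩ := Nat.exists_eq_add_of_le' hn
    exact hY.J_eq_sum hgrid ha hq f n hxy
  · obtain ⟨n, rfl⟩ := Nat.exists_eq_add_of_le' hn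
    exact hY.J_self_eq_passage_add_sum hgrid ha hq f n y

theorem mainTheorem6 {N : ℕ} (grid : Fin (N + 1) → ℝ) (hgrid : StrictMono grid)
    (G : Matrix (Fin (N + 1)) (Fin (N + 1)) ℝ) (hG : CTMCDrawdown.IsRateMatrix G)
    {Ω : Type*} [MeasurableSpace Ω] (P : Fin (N + 1) → Measure Ω)
    (Y : ℝ≥0 → Ω → Fin (N + 1)) (hY : CTMCDrawdown.IsCTMC G P Y)
    (a : ℝ) (ha : 0 < a) (f : Fin (N + 1) → Fin (N + 1) → ℂ)
    (q : ℂ) (hq : 0 < q.re) :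
    -- all the expectations involved are expectations of integrable variables
    (∀ (S : Set ℝ) (g : Fin (N + 1) → ℂ) (x : Fin (N + 1)),
      Integrable (fun ω => CTMCDrawdown.passagePayoff grid S (fun _ => q) g (fun t => Y t ω))
        (P x)) ∧
    (∀ (n : ℕ) (x y : Fin (N + 1)), x ≤ y →
      Integrable (fun ω => CTMCDrawdown.drawdownPayoff grid a f n q y (fun t => Y t ω)) (P x)) ∧
    -- the linear system
    (∀ n : ℕ, 1 ≤ n → ∀ x y : Fin (N + 1), x ≤ y →
      CTMCDrawdown.J grid P Y a f n q x y =
        ∑ z ∈ Finset.univ.filter (fun z => y ≤ z),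
          CTMCDrawdown.passage grid P Y (Set.Iio (grid y)) (fun _ => q) x
            (fun u => if u = z then 1 else 0) *
          CTMCDrawdown.J grid P Y a f n q z z) ∧
    (∀ n : ℕ, 1 ≤ n → ∀ y : Fin (N + 1),
      CTMCDrawdown.J grid P Y a f n q y y =
        CTMCDrawdown.passage grid P Y (Set.Ioc (grid y - a) (grid y)) (fun _ => q) y
          (fun u => CTMCDrawdown.J grid P Y a f (n - 1) q u y *
            (if grid u ≤ grid y - a then 1 else 0)) +
        ∑ z ∈ Finset.univ.filter (fun z => y < z),
          CTMCDrawdown.passage grid P Y (Set.Ioc (grid y - a) (grid y)) (fun _ => q) y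
            (fun u => if u = z then 1 else 0) *
          CTMCDrawdown.J grid P Y a f n q z z) ∧
    -- the initial condition
    (∀ x y : Fin (N + 1), x ≤ y → CTMCDrawdown.J grid P Y a f 0 q x y = f x y) := by
  have h := mainTheorem6_general grid hgrid G P Y hY a ha f q hq.le
  exact ⟨h.1, fun n x y _ => h.2.1 n x y, h.2.2⟩
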